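/- Let $(\Omega,\mathcal F,P)$ be a probability space and $K=\mathbb R$ or $\mathbb C$. Let $L^0(\mathcal F,K)$ be the algebra of $P$-a.s. equivalence classes of $K$-valued random variables, let $L^0=L^0(\mathcal F,\mathbb R)$, ordered by $\le$ $P$-almost surely, and let $L^0_+=\{\xi\in L^0:\xi\ge 0\}$. A random locally convex module $(E,\mathcal P)$ over $K$ with base $(\Omega,\mathcal F,P)$ is an $L^0(\mathcal F,K)$-module $E$ with a family $\mathcal P$ of mappings $\|\cdot\|:E\to L^0_+$ such that $\|\xi x\|=|\xi|\,\|x\|$ and $\|x+y\|\le\|x\|+\|y\|$ for all $\|\cdot\|\in\mathcal P$, $x,y\in E$, $\xi\in L^0(\mathcal F,K)$, and such that $\bigvee\{\|x\|:\|\cdot\|\in\mathcal P\}=0$ if and only if $x=0$. It carries the $(\varepsilon,\lambda)$-topology, the linear topology in which the sets $$\Big\{x\in E: P\Big\{\omega:\Big(\bigvee_{\|\cdot\|\in\mathcal Q}\|x\|\Big)(\omega)<\varepsilon\Big\}>1-\lambda\Big\},\qquad \mathcal Q\subset\mathcal P\text{ finite},\ \varepsilon>0,\ 0<\lambda<1,$$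 form a local base at $0$; $(E,\mathcal P)$ is complete if it is complete for this topology. A set $G\subset E$ is $L^0$-convex if $\xi x+(1-\xi)y\in G$ for all $x,y\in G$ and all $\xi\in L^0$ with $0\le\xi\le1$; it is convex if this holds for all constant $\xi\in[0,1]$. An $L^0$-convex (respectively convex) set $G\subset E$ is called $L^0$-convexly compact (respectively convexly compact, in the sense of Žitković) if every nonempty family of $L^0$-convex (respectively convex) subsets of $G$ that are closed in $G$ has nonempty intersection whenever it has the finite intersection property, i.e. whenever each of its nonempty finite subfamilies has nonempty intersection. **Theorem 5.3.** Let $(E,\mathcal P)$ be a complete random locally convex module over $K$ with base $(\Omega,\mathcal F,P)$ and let $G$ be a closed $L^0$-convex subset of $E$. If $G$ is $L^0$-convexly compact, then $G$ is convexly compact. -/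

import Mathlib

open MeasureTheory Filter Topology Set

noncomputable section

/-- `L⁰(𝓕, K)`: equivalence classes, modulo `P`-almost sure equality, of `K`-valued
random variables. -/
abbrev L0 {Ω : Type*} [MeasurableSpace Ω] (P : Measure Ω) (K : Type*) [RCLike K] : Type _ :=
  Ω →ₘ[P] K

/-- The pointwise operations (already in Mathlib) make `L⁰(𝓕, K)` a commutative ring. -/
instance L0.instCommRing {Ω : Type*} [MeasurableSpace Ω] (P : Measure Ω) (K : Type*) [RCLike K] :
    CommRing (L0 P K) :=
  { (inferInstance : AddCommGroup (Ω →ₘ[P] K)), (inferInstance : CommMonoid (Ω →ₘ[P] K)) with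
    left_distrib := fun a b c => AEEqFun.toGerm_injective (by
      simp only [AEEqFun.mul_toGerm, AEEqFun.add_toGerm, mul_add])
    right_distrib := fun a b c => AEEqFun.toGerm_injective (by
      simp only [AEEqFun.mul_toGerm, AEEqFun.add_toGerm, add_mul])
    zero_mul := fun a => AEEqFun.toGerm_injective (by
      simp only [AEEqFun.mul_toGerm, AEEqFun.zero_toGerm, zero_mul])
    mul_zero := fun a => AEEqFun.toGerm_injective (by
      simp only [AEEqFun.mul_toGerm, AEEqFun.zero_toGerm, mul_zero]) }

/-- `L⁰₊`: the nonnegative elements of `L⁰ = L⁰(𝓕, ℝ)` for the almost sure order. -/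
abbrev L0Plus {Ω : Type*} [MeasurableSpace Ω] (P : Measure Ω) : Type _ :=
  {ξ : L0 P ℝ // 0 ≤ ξ}

/-- The absolute value `|ξ| ∈ L⁰` of `ξ ∈ L⁰(𝓕, K)`. -/
def L0.abs {Ω : Type*} [MeasurableSpace Ω] {P : Measure Ω} {K : Type*} [RCLike K]
    (ξ : L0 P K) : L0 P ℝ :=
  AEEqFun.comp (fun z : K => ‖z‖) continuous_norm ξ

/-- The inclusion of the real algebra `L⁰(𝓕, ℝ)` in `L⁰(𝓕, K)`. -/
def L0.ofReal {Ω : Type*} [MeasurableSpace Ω] {P : Measure Ω} (K : Type*) [RCLike K]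
    (ξ : L0 P ℝ) : L0 P K :=
  AEEqFun.comp (fun t : ℝ => (t : K)) RCLike.continuous_ofReal ξ

/-- The inclusion of `ℝ` in `L⁰(𝓕, K)` as the (classes of) constant random variables. -/
def L0.constHom {Ω : Type*} [MeasurableSpace Ω] (P : Measure Ω) (K : Type*) [RCLike K] :
    ℝ →+* L0 P K where
  toFun t := AEEqFun.const Ω (t : K)
  map_one' := by simp only [RCLike.ofReal_one]; rfl
  map_mul' s t := by simp only [RCLike.ofReal_mul]; rfl
  map_zero' := by simp only [RCLike.ofReal_zero]; rfl
  map_add' s t := by simp only [RCLike.ofReal_add]; rfl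

/-- The real vector space structure of an `L⁰(𝓕, K)`-module: real numbers act as constant
random variables. -/
@[reducible]
def L0.realModule {Ω : Type*} [MeasurableSpace Ω] (P : Measure Ω) (K : Type*) [RCLike K]
    (E : Type*) [AddCommGroup E] [Module (L0 P K) E] : Module ℝ E :=
  Module.compHom E (L0.constHom P K)

/-- `(E, 𝒫)` is a random locally convex module over `K` with base `(Ω, 𝓕, P)`. The family `𝒫`
of `L⁰`-seminorms is indexed by `ι`: its members are the mappings `norm i : E → L⁰₊`. -/
structure RandomLCModule {Ω : Type*} [MeasurableSpace Ω] (P : Measure Ω) (K : Type*) [RCLike K]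
    (ι : Type*) (E : Type*) [AddCommGroup E] [Module (L0 P K) E] where
  /-- the `L⁰`-seminorms -/
  norm : ι → E → L0Plus P
  /-- `⋁ {‖x‖ : ‖·‖ ∈ 𝒫} = 0` if and only if `x = θ` -/
  isLUB_zero_iff : ∀ x : E, IsLUB (range fun i => norm i x) 0 ↔ x = 0
  /-- `‖ξ x‖ = |ξ| ‖x‖` -/
  norm_smul : ∀ (i : ι) (ξ : L0 P K) (x : E),
    (norm i (ξ • x) : L0 P ℝ) = L0.abs ξ * (norm i x : L0 P ℝ)
  /-- `‖x + y‖ ≤ ‖x‖ + ‖y‖` -/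
  norm_add_le : ∀ (i : ι) (x y : E),
    (norm i (x + y) : L0 P ℝ) ≤ (norm i x : L0 P ℝ) + (norm i y : L0 P ℝ)

namespace RandomLCModule

/-- `‖x‖_𝒬 = ⋁ {‖x‖ : ‖·‖ ∈ 𝒬}`, the supremum in `L⁰₊` over a finite subfamily `𝒬`
(it is `0` for the empty subfamily). -/
def supNorm {Ω : Type*} [MeasurableSpace Ω] {P : Measure Ω} {K : Type*} [RCLike K]
    {ι : Type*} {E : Type*} [AddCommGroup E] [Module (L0 P K) E]
    (M : RandomLCModule P K ι E) (Q : Finset ι) (x : E) : L0Plus P :=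
  Q.sup fun i => M.norm i x

/-- `U_θ(𝒬, ε, lam) = {x : P {ω : ‖x‖_𝒬(ω) < ε} > 1 - lam}`. -/
def nhd {Ω : Type*} [MeasurableSpace Ω] {P : Measure Ω} {K : Type*} [RCLike K]
    {ι : Type*} {E : Type*} [AddCommGroup E] [Module (L0 P K) E]
    (M : RandomLCModule P K ι E) (Q : Finset ι) (ε lam : ℝ) : Set E :=
  {x | 1 - lam < P.real {ω | (M.supNorm Q x : L0 P ℝ) ω < ε}}

section Basic

variable {Ω : Type*} [MeasurableSpace Ω] {P : Measure Ω} {K : Type*} [RCLike K]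
  {ι : Type*} {E : Type*} [AddCommGroup E] [Module (L0 P K) E] (M : RandomLCModule P K ι E)

theorem norm_zero (i : ι) : M.norm i 0 = 0 := by
  apply Subtype.ext
  have h := M.norm_smul i 0 0
  have h0 : L0.abs (0 : L0 P K) = 0 := by
    apply AEEqFun.toGerm_injective
    rw [L0.abs, AEEqFun.comp_toGerm]
    change Germ.map _ (((fun _ => 0 : Ω → K) : Germ (ae P) K)) = ((fun _ => 0 : Ω → ℝ) : Germ (ae P) ℝ)
    rw [Germ.map_coe]
    congr 1
    funext ω
    simp
  rw [h0, zero_mul, smul_zero] at h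
  exact h

theorem norm_neg (i : ι) (x : E) : M.norm i (-x) = M.norm i x := by
  apply Subtype.ext
  have h := M.norm_smul i (-1) x
  have h1 : L0.abs (-1 : L0 P K) = 1 := by
    apply AEEqFun.toGerm_injective
    rw [L0.abs, AEEqFun.comp_toGerm]
    change Germ.map _ (((fun _ => -1 : Ω → K) : Germ (ae P) K)) = ((fun _ => 1 : Ω → ℝ) : Germ (ae P) ℝ)
    rw [Germ.map_coe]
    congr 1
    funext ω
    simp
  rw [h1, one_mul, neg_smul, one_smul] at h
  exact h

theorem supNorm_zero (Q : Finset ι) : M.supNorm Q 0 = 0 := by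
  apply le_antisymm
  · exact Finset.sup_le fun i _ => (M.norm_zero i).le
  · exact (M.supNorm Q 0).2

theorem supNorm_neg (Q : Finset ι) (x : E) : M.supNorm Q (-x) = M.supNorm Q x := by
  simp only [supNorm, norm_neg]

theorem L0_add_le_add {a b c d : L0 P ℝ} (h : a ≤ c) (h' : b ≤ d) : a + b ≤ c + d := by
  rw [← AEEqFun.coeFn_le] at h h' ⊢
  filter_upwards [h, h', AEEqFun.coeFn_add a b, AEEqFun.coeFn_add c d] with ω h1 h2 h3 h4
  rw [h3, h4]
  exact add_le_add h1 h2

theorem supNorm_add_le (Q : Finset ι) (x y : E) :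
    (M.supNorm Q (x + y) : L0 P ℝ) ≤ (M.supNorm Q x : L0 P ℝ) + (M.supNorm Q y : L0 P ℝ) := by
  have h0 : (0 : L0 P ℝ) ≤ (M.supNorm Q x : L0 P ℝ) + (M.supNorm Q y : L0 P ℝ) := by
    simpa using L0_add_le_add (M.supNorm Q x).2 (M.supNorm Q y).2
  change M.supNorm Q (x + y) ≤ (⟨_, h0⟩ : L0Plus P)
  refine Finset.sup_le fun i hi => ?_
  have hx : M.norm i x ≤ M.supNorm Q x := Finset.le_sup (f := fun i => M.norm i x) hi
  have hy : M.norm i y ≤ M.supNorm Q y := Finset.le_sup (f := fun i => M.norm i y) hi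
  exact (M.norm_add_le i x y).trans (L0_add_le_add hx hy)

theorem supNorm_mono {Q R : Finset ι} (h : Q ⊆ R) (x : E) : M.supNorm Q x ≤ M.supNorm R x :=
  Finset.sup_mono h

variable [IsProbabilityMeasure P]

theorem nhd_mono {Q R : Finset ι} (h : Q ⊆ R) {ε δ lam lam' : ℝ} (hε : ε ≤ δ) (hlam : lam ≤ lam') :
    M.nhd R ε lam ⊆ M.nhd Q δ lam' := by
  intro x hx
  have hx' : 1 - lam < P.real {ω | (M.supNorm R x : L0 P ℝ) ω < ε} := hx
  change 1 - lam' < P.real {ω | (M.supNorm Q x : L0 P ℝ) ω < δ}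
  refine lt_of_lt_of_le (by linarith) ?_
  refine ENNReal.toReal_mono (measure_ne_top _ _) (measure_mono_ae ?_)
  have hle : (M.supNorm Q x : L0 P ℝ) ≤ (M.supNorm R x : L0 P ℝ) := M.supNorm_mono h x
  filter_upwards [AEEqFun.coeFn_le.2 hle] with ω hω
  intro (h1 : (M.supNorm R x : L0 P ℝ) ω < ε)
  exact hω.trans_lt (h1.trans_le hε)

theorem zero_mem_nhd (Q : Finset ι) {ε lam : ℝ} (hε : 0 < ε) (hlam : 0 < lam) :
    (0 : E) ∈ M.nhd Q ε lam := by
  change 1 - lam < P.real {ω | (M.supNorm Q 0 : L0 P ℝ) ω < ε}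
  have h : P.real {ω | (M.supNorm Q 0 : L0 P ℝ) ω < ε} = 1 := by
    have hae : ∀ᵐ ω ∂P, ω ∈ {ω | (M.supNorm Q 0 : L0 P ℝ) ω < ε} := by
      rw [supNorm_zero]
      filter_upwards [(AEEqFun.coeFn_zero : ⇑(0 : L0 P ℝ) =ᵐ[P] 0)] with ω hω
      change ((0 : L0 P ℝ) : Ω → ℝ) ω < ε
      rw [hω]
      exact hε
    have h1 : P {ω | (M.supNorm Q 0 : L0 P ℝ) ω < ε} = 1 := mem_ae_iff_prob_eq_one
      (measurableSet_lt (AEEqFun.measurable _) measurable_const) |>.1 hae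
    rw [measureReal_def, h1, ENNReal.toReal_one]
  rw [h]
  linarith

theorem nhd_add (Q : Finset ι) (ε lam : ℝ) {x y : E} (hx : x ∈ M.nhd Q (ε / 2) (lam / 2))
    (hy : y ∈ M.nhd Q (ε / 2) (lam / 2)) : x + y ∈ M.nhd Q ε lam := by
  have hx' : 1 - lam / 2 < P.real {ω | (M.supNorm Q x : L0 P ℝ) ω < ε / 2} := hx
  have hy' : 1 - lam / 2 < P.real {ω | (M.supNorm Q y : L0 P ℝ) ω < ε / 2} := hy
  change 1 - lam < P.real {ω | (M.supNorm Q (x + y) : L0 P ℝ) ω < ε}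
  have hm : MeasurableSet {ω | (M.supNorm Q y : L0 P ℝ) ω < ε / 2} :=
    measurableSet_lt (AEEqFun.measurable _) measurable_const
  have h1 := measureReal_union_add_inter (μ := P)
    (s := {ω | (M.supNorm Q x : L0 P ℝ) ω < ε / 2}) hm
  have h2 : P.real ({ω | (M.supNorm Q x : L0 P ℝ) ω < ε / 2} ∪
    {ω | (M.supNorm Q y : L0 P ℝ) ω < ε / 2}) ≤ 1 := measureReal_le_one
  refine lt_of_lt_of_le (by linarith : 1 - lam < P.real
    ({ω | (M.supNorm Q x : L0 P ℝ) ω < ε / 2} ∩ {ω | (M.supNorm Q y : L0 P ℝ) ω < ε / 2})) ?_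
  refine ENNReal.toReal_mono (measure_ne_top _ _) (measure_mono_ae ?_)
  filter_upwards [AEEqFun.coeFn_le.2 (M.supNorm_add_le Q x y),
    AEEqFun.coeFn_add (M.supNorm Q x : L0 P ℝ) (M.supNorm Q y : L0 P ℝ)] with ω h3 h4
  rintro ⟨h5 : (M.supNorm Q x : L0 P ℝ) ω < ε / 2, h6 : (M.supNorm Q y : L0 P ℝ) ω < ε / 2⟩
  rw [h4] at h3
  change (M.supNorm Q (x + y) : L0 P ℝ) ω < ε
  have h7 : (M.supNorm Q (x + y) : L0 P ℝ) ω ≤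
    (M.supNorm Q x : L0 P ℝ) ω + (M.supNorm Q y : L0 P ℝ) ω := h3
  linarith

end Basic

/-- The sets `U_θ(𝒬, ε, lam)`, for `𝒬` a finite subfamily of `𝒫`, `ε > 0` and `0 < lam < 1`, form
a base at `θ` of a group topology. (The empty subfamily only contributes the whole space, so
it changes nothing when `𝒫` is nonempty.) -/
@[reducible]
def basis {Ω : Type*} [MeasurableSpace Ω] {P : Measure Ω} [IsProbabilityMeasure P]
    {K : Type*} [RCLike K] {ι : Type*} {E : Type*} [AddCommGroup E] [Module (L0 P K) E]
    (M : RandomLCModule P K ι E) : AddGroupFilterBasis E :=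
  addGroupFilterBasisOfComm
    {U | ∃ (Q : Finset ι) (ε lam : ℝ), 0 < ε ∧ 0 < lam ∧ lam < 1 ∧ U = M.nhd Q ε lam}
    ⟨_, ∅, 1, 1 / 2, by norm_num, by norm_num, by norm_num, rfl⟩
    (by
      classical
      rintro _ _ ⟨Q, ε, lam, hε, hl, hl1, rfl⟩ ⟨R, δ, lam', hδ, hl', hl1', rfl⟩
      exact ⟨_, ⟨Q ∪ R, min ε δ, min lam lam', lt_min hε hδ, lt_min hl hl', min_lt_of_left_lt hl1,
        rfl⟩, subset_inter
          (M.nhd_mono Finset.subset_union_left (min_le_left _ _) (min_le_left _ _))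
          (M.nhd_mono Finset.subset_union_right (min_le_right _ _) (min_le_right _ _))⟩)
    (by
      rintro _ ⟨Q, ε, lam, hε, hl, hl1, rfl⟩
      exact M.zero_mem_nhd Q hε hl)
    (by
      rintro _ ⟨Q, ε, lam, hε, hl, hl1, rfl⟩
      refine ⟨_, ⟨Q, ε / 2, lam / 2, by linarith, by linarith, by linarith, rfl⟩, ?_⟩
      rintro _ ⟨x, hx, y, hy, rfl⟩
      exact M.nhd_add Q ε lam hx hy)
    (by
      rintro _ ⟨Q, ε, lam, hε, hl, hl1, rfl⟩
      refine ⟨_, ⟨Q, ε, lam, hε, hl, hl1, rfl⟩, ?_⟩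
      intro x hx
      change 1 - lam < P.real {ω | (M.supNorm Q (-x) : L0 P ℝ) ω < ε}
      rw [supNorm_neg]
      exact hx)

/-- The `(ε, λ)`-topology of a random locally convex module. -/
@[reducible]
def topology {Ω : Type*} [MeasurableSpace Ω] {P : Measure Ω} [IsProbabilityMeasure P]
    {K : Type*} [RCLike K] {ι : Type*} {E : Type*} [AddCommGroup E] [Module (L0 P K) E]
    (M : RandomLCModule P K ι E) : TopologicalSpace E :=
  M.basis.topology

/-- `(E, 𝒫)` is complete: every Cauchy filter converges, for the uniform structure of the
additive topological group `E` with its `(ε, λ)`-topology. -/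
def IsComplete {Ω : Type*} [MeasurableSpace Ω] {P : Measure Ω} [IsProbabilityMeasure P]
    {K : Type*} [RCLike K] {ι : Type*} {E : Type*} [AddCommGroup E] [Module (L0 P K) E]
    (M : RandomLCModule P K ι E) : Prop :=
  @CompleteSpace E M.basis.uniformSpace

end RandomLCModule

/-- `G` is `L⁰`-convex: `ξ x + (1 - ξ) y ∈ G` for `x, y ∈ G` and `ξ ∈ L⁰₊` with `0 ≤ ξ ≤ 1`. -/
def IsL0Convex {Ω : Type*} [MeasurableSpace Ω] (P : Measure Ω) (K : Type*) [RCLike K]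
    {E : Type*} [AddCommGroup E] [Module (L0 P K) E] (G : Set E) : Prop :=
  ∀ x ∈ G, ∀ y ∈ G, ∀ ξ : L0 P ℝ, 0 ≤ ξ → ξ ≤ 1 →
    L0.ofReal K ξ • x + (1 - L0.ofReal K ξ) • y ∈ G

/-- `G` is convex in the ordinary sense, for the underlying real vector space. -/
def IsOrdConvex {Ω : Type*} [MeasurableSpace Ω] (P : Measure Ω) (K : Type*) [RCLike K]
    {E : Type*} [AddCommGroup E] [Module (L0 P K) E] (G : Set E) : Prop :=
  letI := L0.realModule P K E
  Convex ℝ G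

/-- Compactness of `G` with respect to the closed subsets of `G` with property `C`: every
nonempty family of subsets of `G` which are closed in `G` (for the subspace topology) and have
property `C` has nonempty intersection whenever it has the finite intersection property. -/
def IsFIPCompact {E : Type*} (t : TopologicalSpace E) (C : Set E → Prop) (G : Set E) : Prop :=
  ∀ 𝓕 : Set (Set E), 𝓕.Nonempty →
    (∀ F ∈ 𝓕, C F ∧ ∃ Z : Set E, IsClosed[t] Z ∧ F = G ∩ Z) →
    (∀ 𝓢 ⊆ 𝓕, 𝓢.Finite → 𝓢.Nonempty → (⋂₀ 𝓢).Nonempty) →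
    (⋂₀ 𝓕).Nonempty

/-- `G` is `L⁰`-convexly compact (`t` is the topology of `E`). -/
def IsL0ConvexlyCompact {Ω : Type*} [MeasurableSpace Ω] (P : Measure Ω) (K : Type*) [RCLike K]
    {E : Type*} [AddCommGroup E] [Module (L0 P K) E] (t : TopologicalSpace E) (G : Set E) :
    Prop :=
  IsL0Convex P K G ∧ IsFIPCompact t (IsL0Convex P K) G

/-- `G` is convexly compact in the sense of Žitković (`t` is the topology of `E`). -/
def IsConvexlyCompact {Ω : Type*} [MeasurableSpace Ω] (P : Measure Ω) (K : Type*) [RCLike K]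
    {E : Type*} [AddCommGroup E] [Module (L0 P K) E] (t : TopologicalSpace E) (G : Set E) :
    Prop :=
  IsOrdConvex P K G ∧ IsFIPCompact t (IsOrdConvex P K) G

end

/-!
The idea is to represent ordinary continuous functionals by *random* functionals, because
`L⁰`-convex compactness controls the latter pointwise in `ω`.

Let `N` be an `L⁰`-seminorm. On the real vector space `N.L1Space` of those `x` with
`∫ N x < ∞`, every functional `f` that is continuous for the seminorm `x ↦ ∫ N x` has a random
density (`L0Seminorm.density`): an `L⁰`-linear map `g : E → L⁰` with `|g x| ≤ ‖f‖ N x` and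
`f (ξ x) = ∫ ξ g x` for small multipliers `ξ`. It comes from the Riesz representation of
`ξ ↦ f (ξ x)` on `L²`, and it is defined on all of `E`, since any `x` can be shrunk into
`N.L1Space` by a positive element of `L⁰`.

An `L⁰`-convex set contains the concatenations of its points along measurable sets. Hence a local
map (one that respects concatenation) with closed `L⁰`-convex sublevel sets attains a minimum, for
the almost sure order, on an `L⁰`-convexly compact set `G` (`IsLocalMap.exists_forall_le`). Three
consequences carry the proof.

* Each random functional dominated by a seminorm is bounded on `G` by an element of `L⁰`, as `g`
  and `-g` attain their minima. By the Baire category theorem in the dual of `N.L1Space` the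
  seminorms themselves are bounded in probability on `G`, and then, as concatenation makes their
  values on `G` directed, bounded by an element `S` of `L⁰`
  (`IsEpsilonLambda.exists_forall_seminorm_le`).
* Along an ultrafilter `𝒰` on `G`, the values of finitely many random functionals bounded by `1` on
  `G` have weak limits `γ j` in `L²`, and one point `x` of `G` satisfies `g j x = γ j` for all `j`:
  the variational inequality at a minimum `x` of `∑ (g j x - γ j)²`, integrated and passed to the
  limit, reads `∑ ‖g j x - γ j‖² ≤ 0` (`IsEpsilonLambda.exists_forall_eq_weak_limit`).
* The sets `{x ∈ G | g x = γ}` are closed and `L⁰`-convex, so a single `x ∈ G` serves for all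
  bounded random functionals at once.

Given a family of relatively closed convex subsets of `G` with the finite intersection property,
let `𝒰` be an ultrafilter containing it. The point `x` just found lies in every member `F`:
otherwise `x` is at positive distance from `F` for the seminorm `z ↦ ∫ N z / (1 + S)`, for a suitable
one of the seminorms `N`; the Hahn–Banach theorem yields a functional `f` that strictly separates
`x` from `F`; but `f` is the integral of its random density, so `f y` tends to `f x` along `𝒰`.
-/

noncomputable section

/-! ### Elements of `L⁰` and `L⁰`-seminorms -/

namespace L0

variable {Ω : Type*} [MeasurableSpace Ω] {P : Measure Ω}

/-- The class of `1 / (1 + |u|)`, a strictly positive multiplier whose product with `u` is bounded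
by `1`. -/
def rcp (u : L0 P ℝ) : L0 P ℝ :=
  AEEqFun.compMeasurable (fun t : ℝ => (1 + |t|)⁻¹) (by fun_prop) u

theorem coeFn_rcp (u : L0 P ℝ) : ∀ᵐ ω ∂P, rcp u ω = (1 + |u ω|)⁻¹ :=
  AEEqFun.coeFn_compMeasurable _ _ u

/-- The class of the indicator function of a measurable set. -/
def ind (B : Set Ω) (hB : MeasurableSet B) : L0 P ℝ :=
  AEEqFun.mk (B.indicator 1) (measurable_one.indicator hB).aestronglyMeasurable

theorem coeFn_ind (B : Set Ω) (hB : MeasurableSet B) :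
    ∀ᵐ ω ∂P, (ind B hB : L0 P ℝ) ω = B.indicator 1 ω :=
  AEEqFun.coeFn_mk _ _

theorem ae_add (a b : L0 P ℝ) : ∀ᵐ ω ∂P, (a + b) ω = a ω + b ω := AEEqFun.coeFn_add a b
theorem ae_sub (a b : L0 P ℝ) : ∀ᵐ ω ∂P, (a - b) ω = a ω - b ω := AEEqFun.coeFn_sub a b
theorem ae_neg (a : L0 P ℝ) : ∀ᵐ ω ∂P, (-a) ω = -a ω := AEEqFun.coeFn_neg a
theorem ae_mul (a b : L0 P ℝ) : ∀ᵐ ω ∂P, (a * b) ω = a ω * b ω := AEEqFun.coeFn_mul a b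
theorem ae_smul (r : ℝ) (a : L0 P ℝ) : ∀ᵐ ω ∂P, (r • a) ω = r * a ω := AEEqFun.coeFn_smul r a
theorem ae_zero : ∀ᵐ ω ∂P, (0 : L0 P ℝ) ω = 0 := AEEqFun.coeFn_zero
theorem ae_one : ∀ᵐ ω ∂P, (1 : L0 P ℝ) ω = 1 := AEEqFun.coeFn_one

theorem le_iff {a b : L0 P ℝ} : a ≤ b ↔ ∀ᵐ ω ∂P, a ω ≤ b ω := AEEqFun.coeFn_le.symm

theorem integrable_of_ae_abs_le [IsProbabilityMeasure P] {γ : Ω → ℝ} (hγ : AEStronglyMeasurable γ P)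
    {C : ℝ} (h : ∀ᵐ ω ∂P, |γ ω| ≤ C) : Integrable γ P :=
  Integrable.of_bound hγ C h

/-- An element of `L⁰` is determined by its integrals against the multipliers that are small
relative to a prescribed `u`. -/
theorem ae_eq_zero_of_forall_integral_mul [IsProbabilityMeasure P] (γ u : L0 P ℝ)
    (h : ∀ ξ : L0 P ℝ, (∀ᵐ ω ∂P, |ξ ω| * (1 + |u ω|) ≤ 1) → ∫ ω, ξ ω * γ ω ∂P = 0) :
    γ = 0 := by
  -- a multiplier with the sign of `γ`, small enough that its product with `γ` is bounded
  let f : Ω → ℝ := fun ω => γ ω / ((1 + |u ω|) * (1 + γ ω ^ 2))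
  have hγ := γ.measurable
  have hu := u.measurable
  have hf : AEStronglyMeasurable f P := by
    apply Measurable.aestronglyMeasurable
    fun_prop
  have hξ : ∀ᵐ ω ∂P, (AEEqFun.mk f hf : L0 P ℝ) ω = f ω := AEEqFun.coeFn_mk _ _
  have h1 := h (AEEqFun.mk f hf) (by
    filter_upwards [hξ] with ω hω
    have h1 : (0 : ℝ) < 1 + |u ω| := by positivity
    have h2 : (0 : ℝ) < 1 + γ ω ^ 2 := by positivity
    have h3 : |γ ω| ≤ 1 + γ ω ^ 2 := by
      nlinarith [sq_abs (γ ω), sq_nonneg (|γ ω| - 1), abs_nonneg (γ ω)]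
    rw [hω]
    simp only [f]
    rw [abs_div, abs_mul, abs_of_pos h1, abs_of_pos h2]
    rw [div_mul_eq_mul_div, div_le_one (by positivity)]
    nlinarith)
  have hnn : 0 ≤ᵐ[P] fun ω => (AEEqFun.mk f hf : L0 P ℝ) ω * γ ω := by
    filter_upwards [hξ] with ω hω
    rw [hω]
    have : f ω * γ ω = γ ω ^ 2 / ((1 + |u ω|) * (1 + γ ω ^ 2)) := by simp only [f]; ring
    rw [this]
    simp only [Pi.zero_apply]
    positivity
  have hint : Integrable (fun ω => (AEEqFun.mk f hf : L0 P ℝ) ω * γ ω) P := by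
    refine integrable_of_ae_abs_le
      ((AEEqFun.aestronglyMeasurable _).mul γ.aestronglyMeasurable) (C := 1) ?_
    filter_upwards [hξ] with ω hω
    rw [hω]
    have : f ω * γ ω = γ ω ^ 2 / ((1 + |u ω|) * (1 + γ ω ^ 2)) := by simp only [f]; ring
    rw [this, abs_of_nonneg (by positivity)]
    rw [div_le_one (by positivity)]
    nlinarith [abs_nonneg (u ω), sq_nonneg (γ ω), mul_nonneg (abs_nonneg (u ω)) (sq_nonneg (γ ω))]
  have h2 := (integral_eq_zero_iff_of_nonneg_ae hnn hint).1 h1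
  apply AEEqFun.ext
  filter_upwards [h2, hξ, ae_zero (P := P)] with ω h3 h4 h5
  rw [h5]
  rw [h4] at h3
  simp only [f, Pi.zero_apply] at h3
  have h1 : (0 : ℝ) < 1 + |u ω| := by positivity
  have h2 : (0 : ℝ) < 1 + γ ω ^ 2 := by positivity
  rcases mul_eq_zero.1 h3 with h6 | h6
  · rcases div_eq_zero_iff.1 h6 with h7 | h7
    · exact h7
    · exact absurd h7 (by positivity)
  · exact h6

end L0

/-- An `L⁰`-seminorm on an `L⁰(𝓕, ℝ)`-module, with its laws stated almost surely. -/
structure L0Seminorm {Ω : Type*} [MeasurableSpace Ω] (P : Measure Ω) (E : Type*) [AddCommGroup E]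
    [Module (L0 P ℝ) E] where
  /-- the underlying map -/
  toFun : E → L0 P ℝ
  nonneg' : ∀ x, ∀ᵐ ω ∂P, 0 ≤ toFun x ω
  add_le' : ∀ x y, ∀ᵐ ω ∂P, toFun (x + y) ω ≤ toFun x ω + toFun y ω
  smul' : ∀ (ξ : L0 P ℝ) x, ∀ᵐ ω ∂P, toFun (ξ • x) ω = |ξ ω| * toFun x ω

namespace L0Seminorm

variable {Ω : Type*} [MeasurableSpace Ω] {P : Measure Ω} {E : Type*} [AddCommGroup E]
    [Module (L0 P ℝ) E]

instance : CoeFun (L0Seminorm P E) fun _ => E → L0 P ℝ := ⟨toFun⟩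

variable (N : L0Seminorm P E)

theorem nonneg (x : E) : ∀ᵐ ω ∂P, 0 ≤ N x ω := N.nonneg' x
theorem add_le (x y : E) : ∀ᵐ ω ∂P, N (x + y) ω ≤ N x ω + N y ω := N.add_le' x y
theorem smul (ξ : L0 P ℝ) (x : E) : ∀ᵐ ω ∂P, N (ξ • x) ω = |ξ ω| * N x ω := N.smul' ξ x

theorem zero : ∀ᵐ ω ∂P, N 0 ω = 0 := by
  filter_upwards [N.smul 0 0, L0.ae_zero (P := P)] with ω h1 h2
  rw [smul_zero, h2, abs_zero, zero_mul] at h1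
  exact h1

theorem neg (x : E) : ∀ᵐ ω ∂P, N (-x) ω = N x ω := by
  filter_upwards [N.smul (-1) x, L0.ae_one (P := P), L0.ae_neg (1 : L0 P ℝ)] with ω h1 h2 h3
  rw [neg_smul, one_smul, h3, h2] at h1
  simpa using h1

theorem rcp_smul (x : E) : ∀ᵐ ω ∂P, N (L0.rcp (N x) • x) ω = (1 + N x ω)⁻¹ * N x ω := by
  filter_upwards [N.smul (L0.rcp (N x)) x, L0.coeFn_rcp (N x), N.nonneg x] with ω h1 h2 h3
  rw [h1, h2, abs_of_nonneg h3, abs_of_nonneg (by positivity)]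

/-- Every element of `E` is brought into the unit ball of `N` by a strictly positive multiplier. -/
theorem rcp_smul_le_one (x : E) : ∀ᵐ ω ∂P, N (L0.rcp (N x) • x) ω ≤ 1 := by
  filter_upwards [N.rcp_smul x, N.nonneg x] with ω h1 h3
  rw [h1, inv_mul_le_one₀ (by positivity)]
  linarith

variable [Module ℝ E] [IsScalarTower ℝ (L0 P ℝ) E]

theorem real_smul (r : ℝ) (x : E) : ∀ᵐ ω ∂P, N (r • x) ω = |r| * N x ω := by
  have h : r • x = (r • (1 : L0 P ℝ)) • x := by rw [smul_assoc, one_smul]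
  rw [h]
  filter_upwards [N.smul (r • (1 : L0 P ℝ)) x, L0.ae_one (P := P), L0.ae_smul r (1 : L0 P ℝ)]
    with ω h1 h2 h3
  rw [h1, h3, h2, mul_one]

/-- The real vector space of those `x` for which `N x` is integrable. -/
def L1Space : Submodule ℝ E where
  carrier := {x | Integrable (N x) P}
  zero_mem' := (integrable_zero Ω ℝ P).congr (by
    filter_upwards [N.zero] with ω h; simp [h])
  add_mem' {x y} hx hy := by
    refine Integrable.mono' (Integrable.add hx hy) (AEEqFun.aestronglyMeasurable _) ?_
    filter_upwards [N.add_le x y, N.nonneg (x + y)] with ω h1 h2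
    rw [Real.norm_eq_abs, abs_of_nonneg h2]
    exact h1
  smul_mem' r x hx := by
    refine Integrable.congr (Integrable.const_mul hx |r|) ?_
    filter_upwards [N.real_smul r x] with ω h1
    rw [h1]

theorem mem_L1Space_of_ae_le {x : E} {u : Ω → ℝ} (hu : Integrable u P)
    (h : ∀ᵐ ω ∂P, N x ω ≤ u ω) : x ∈ N.L1Space := by
  refine Integrable.mono' hu (AEEqFun.aestronglyMeasurable _) ?_
  filter_upwards [h, N.nonneg x] with ω h1 h2
  rwa [Real.norm_eq_abs, abs_of_nonneg h2]

/-- The seminorm `x ↦ ∫ N x` on `N.L1Space`. -/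
def integralSeminorm : Seminorm ℝ N.L1Space where
  toFun x := ∫ ω, N (x : E) ω ∂P
  map_zero' := by
    refine integral_eq_zero_of_ae ?_
    filter_upwards [N.zero] with ω h
    simpa using h
  add_le' x y := by
    rw [← integral_add x.2 y.2]
    exact integral_mono_ae (x + y).2 (Integrable.add x.2 y.2) (N.add_le x y)
  neg' x := integral_congr_ae (N.neg (x : E))
  smul' r x := by
    rw [Real.norm_eq_abs, ← integral_const_mul]
    exact integral_congr_ae (N.real_smul r (x : E))

instance : SeminormedAddCommGroup N.L1Space :=
  N.integralSeminorm.toAddGroupSeminorm.toSeminormedAddCommGroup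

theorem norm_def (x : N.L1Space) : ‖x‖ = ∫ ω, N (x : E) ω ∂P := rfl

instance : NormedSpace ℝ N.L1Space where
  norm_smul_le r x := (map_smul_eq_mul N.integralSeminorm r x).le

end L0Seminorm

/-! ### Densities of functionals at a point -/

theorem MeasureTheory.Lp.integral_abs_le_norm {Ω : Type*} [MeasurableSpace Ω] {P : Measure Ω}
    [IsProbabilityMeasure P] (ξ : Lp ℝ 2 P) : ∫ ω, |ξ ω| ∂P ≤ ‖ξ‖ := by
  have h1 : ∫ ω, ‖ξ ω‖ ∂P = (eLpNorm ξ 1 P).toReal := by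
    rw [integral_norm_eq_lintegral_enorm (Lp.aestronglyMeasurable ξ), eLpNorm_one_eq_lintegral_enorm]
  simp only [Real.norm_eq_abs] at h1
  rw [h1, Lp.norm_def]
  exact ENNReal.toReal_mono (Lp.eLpNorm_ne_top ξ)
    (eLpNorm_le_eLpNorm_of_exponent_le (by norm_num) (Lp.aestronglyMeasurable ξ))

namespace L0Seminorm

variable {Ω : Type*} [MeasurableSpace Ω] {P : Measure Ω} [IsProbabilityMeasure P]
  {E : Type*} [AddCommGroup E] [Module (L0 P ℝ) E]
  [Module ℝ E] [IsScalarTower ℝ (L0 P ℝ) E] (N : L0Seminorm P E)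

theorem Lp_smul_mem {z : E} (hz : ∀ᵐ ω ∂P, N z ω ≤ 1) (ξ : Lp ℝ 2 P) :
    (ξ : L0 P ℝ) • z ∈ N.L1Space := by
  have hi : Integrable (fun ω => |ξ ω|) P :=
    ((Lp.memLp ξ).integrable (by norm_num)).abs
  refine N.mem_L1Space_of_ae_le hi ?_
  filter_upwards [N.smul (ξ : L0 P ℝ) z, hz] with ω h1 h2
  rw [h1]
  exact mul_le_of_le_one_right (abs_nonneg _) h2

/-- For `z` with `N z ≤ 1`, the continuous functional `ξ ↦ f (ξ z)` on `L²`. -/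
def multiplierFunctional (f : StrongDual ℝ N.L1Space) {z : E} (hz : ∀ᵐ ω ∂P, N z ω ≤ 1) :
    StrongDual ℝ (Lp ℝ 2 P) :=
  LinearMap.mkContinuous
    { toFun := fun ξ => f ⟨(ξ : L0 P ℝ) • z, N.Lp_smul_mem hz ξ⟩
      map_add' := fun ξ η => by
        rw [← map_add]
        congr 1
        apply Subtype.ext
        change ((ξ + η : Lp ℝ 2 P) : L0 P ℝ) • z = (ξ : L0 P ℝ) • z + (η : L0 P ℝ) • z
        rw [← add_smul]
        rfl
      map_smul' := fun r ξ => by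
        rw [RingHom.id_apply, ← map_smul]
        congr 1
        apply Subtype.ext
        change ((r • ξ : Lp ℝ 2 P) : L0 P ℝ) • z = r • ((ξ : L0 P ℝ) • z)
        rw [← smul_assoc]
        rfl }
    ‖f‖ (fun ξ => by
      refine (f.le_opNorm _).trans (mul_le_mul_of_nonneg_left ?_ (norm_nonneg f))
      refine le_trans ?_ (Lp.integral_abs_le_norm ξ)
      rw [norm_def]
      refine integral_mono_ae (N.Lp_smul_mem hz ξ) ((Lp.memLp ξ).integrable (by norm_num)).abs ?_
      filter_upwards [N.smul (ξ : L0 P ℝ) z, hz] with ω h1 h2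
      rw [h1]
      exact mul_le_of_le_one_right (abs_nonneg _) h2)

/-- The Riesz representation of `ξ ↦ f (ξ z)`, when `N z ≤ 1`. -/
theorem exists_density_of_le_one (f : StrongDual ℝ N.L1Space) {z : E}
    (hz : ∀ᵐ ω ∂P, N z ω ≤ 1) :
    ∃ r : L0 P ℝ, (∀ᵐ ω ∂P, |r ω| ≤ ‖f‖ * N z ω) ∧
      ∀ ξ : L0 P ℝ, (∀ᵐ ω ∂P, |ξ ω| ≤ 1) → ∀ h : ξ • z ∈ N.L1Space,
        f ⟨ξ • z, h⟩ = ∫ ω, ξ ω * r ω ∂P := by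
  let r : Lp ℝ 2 P := (InnerProductSpace.toDual ℝ _).symm (N.multiplierFunctional f hz)
  have key : ∀ ξ : L0 P ℝ, (∀ᵐ ω ∂P, |ξ ω| ≤ 1) → ∀ h : ξ • z ∈ N.L1Space,
        f ⟨ξ • z, h⟩ = ∫ ω, ξ ω * r ω ∂P := by
    intro ξ hξ h
    have hm : MemLp ξ 2 P := MemLp.of_bound (AEEqFun.aestronglyMeasurable _) 1 hξ
    have he : ((hm.toLp ξ : Lp ℝ 2 P) : L0 P ℝ) = ξ := AEEqFun.mk_coeFn ξ
    have h1 : inner ℝ r (hm.toLp ξ) = N.multiplierFunctional f hz (hm.toLp ξ) :=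
      InnerProductSpace.toDual_symm_apply
    have h2 : N.multiplierFunctional f hz (hm.toLp ξ) = f ⟨ξ • z, h⟩ := by
      change f ⟨((hm.toLp ξ : Lp ℝ 2 P) : L0 P ℝ) • z, _⟩ = _
      congr 1
      apply Subtype.ext
      change ((hm.toLp ξ : Lp ℝ 2 P) : L0 P ℝ) • z = ξ • z
      rw [he]
    rw [← h2, ← h1, L2.inner_def]
    refine integral_congr_ae ?_
    filter_upwards [hm.coeFn_toLp] with ω h3
    rw [h3]
    simp
  have hzi : Integrable (N z) P := N.mem_L1Space_of_ae_le (integrable_const (1 : ℝ)) hz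
  have hri : Integrable r P := (Lp.memLp r).integrable (by norm_num)
  refine ⟨(r : L0 P ℝ), ?_, key⟩
  refine ae_le_of_forall_setIntegral_le hri.abs (hzi.const_mul ‖f‖) ?_
  intro B hB _
  -- test against the sign of the density, restricted to `B`
  let s : Ω → ℝ := B.indicator fun ω => SignType.sign (r ω)
  have hrm : Measurable r := (r : L0 P ℝ).measurable
  have hsgn : Measurable fun ω => ((SignType.sign (r ω) : SignType) : ℝ) := by
    have : (fun ω => ((SignType.sign (r ω) : SignType) : ℝ)) =
        fun ω => if 0 < r ω then (1 : ℝ) else if r ω < 0 then -1 else 0 := by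
      funext ω
      rw [sign_apply]
      split_ifs <;> simp
    rw [this]
    refine Measurable.ite (measurableSet_lt measurable_const hrm) measurable_const ?_
    exact Measurable.ite (measurableSet_lt hrm measurable_const) measurable_const measurable_const
  have hs : AEStronglyMeasurable s P := (hsgn.indicator hB).aestronglyMeasurable
  have hξ : ∀ᵐ ω ∂P, (AEEqFun.mk s hs : L0 P ℝ) ω = s ω := AEEqFun.coeFn_mk _ _
  have hsle : ∀ ω, |s ω| ≤ B.indicator 1 ω := by
    intro ω
    by_cases hω : ω ∈ B
    · simp only [s, indicator_of_mem hω, Pi.one_apply, sign_apply]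
      split_ifs <;> simp
    · simp [s, hω]
  have hsle1 : ∀ ω, |s ω| ≤ 1 := fun ω =>
    (hsle ω).trans (indicator_le_self' (f := (1 : Ω → ℝ)) (fun _ _ => zero_le_one) ω)
  have hle : ∀ᵐ ω ∂P, N ((AEEqFun.mk s hs : L0 P ℝ) • z) ω ≤ B.indicator (N z) ω := by
    filter_upwards [N.smul (AEEqFun.mk s hs) z, hξ, N.nonneg z] with ω h1 h2 h3
    rw [h1, h2]
    refine (mul_le_mul_of_nonneg_right (hsle ω) h3).trans ?_
    by_cases hω : ω ∈ B <;> simp [hω]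
  have hmem : (AEEqFun.mk s hs : L0 P ℝ) • z ∈ N.L1Space :=
    N.mem_L1Space_of_ae_le (hzi.indicator hB) hle
  have h1 := key (AEEqFun.mk s hs) (by filter_upwards [hξ] with ω h; rw [h]; exact hsle1 ω) hmem
  have h2 : ∫ ω, (AEEqFun.mk s hs : L0 P ℝ) ω * r ω ∂P = ∫ ω in B, |r ω| ∂P := by
    rw [← integral_indicator hB]
    refine integral_congr_ae ?_
    filter_upwards [hξ] with ω h
    rw [h]
    by_cases hω : ω ∈ B
    · simp only [s, indicator_of_mem hω]
      rw [mul_comm, self_mul_sign]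
    · simp [s, hω]
  change ∫ ω in B, |r ω| ∂P ≤ _
  rw [← h2, ← h1, integral_const_mul, ← integral_indicator hB]
  refine (le_abs_self _).trans ((f.le_opNorm _).trans ?_)
  refine mul_le_mul_of_nonneg_left ?_ (norm_nonneg f)
  rw [norm_def]
  exact integral_mono_ae hmem (hzi.indicator hB) hle

/-- Every continuous functional on `N.L1Space` has a random density at every `x : E`, integrable
or not. -/
theorem exists_density (f : StrongDual ℝ N.L1Space) (x : E) :
    ∃ γ : L0 P ℝ, (∀ᵐ ω ∂P, |γ ω| ≤ ‖f‖ * N x ω) ∧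
      ∀ ξ : L0 P ℝ, (∀ᵐ ω ∂P, |ξ ω| * (1 + N x ω) ≤ 1) → ∀ h : ξ • x ∈ N.L1Space,
        f ⟨ξ • x, h⟩ = ∫ ω, ξ ω * γ ω ∂P := by
  obtain ⟨r, hr, hr'⟩ := N.exists_density_of_le_one f (N.rcp_smul_le_one x)
  refine ⟨r * (1 + N x), ?_, ?_⟩
  · filter_upwards [hr, N.rcp_smul x, N.nonneg x, L0.ae_mul r (1 + N x), L0.ae_add 1 (N x),
      L0.ae_one (P := P)] with ω h1 h2 h3 h4 h5 h6
    rw [h4, h5, h6, abs_mul, abs_of_nonneg (by positivity : 0 ≤ 1 + N x ω)]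
    rw [h2] at h1
    calc |r ω| * (1 + N x ω) ≤ ‖f‖ * ((1 + N x ω)⁻¹ * N x ω) * (1 + N x ω) := by gcongr
      _ = ‖f‖ * N x ω := by field_simp
  · intro ξ hξ h
    have he : (ξ * (1 + N x)) * L0.rcp (N x) = ξ := by
      apply AEEqFun.ext
      filter_upwards [L0.ae_mul (ξ * (1 + N x)) (L0.rcp (N x)), L0.ae_mul ξ (1 + N x),
        L0.ae_add 1 (N x), L0.ae_one (P := P), L0.coeFn_rcp (N x), N.nonneg x]
        with ω h1 h2 h3 h4 h5 h6
      rw [h1, h2, h3, h4, h5, abs_of_nonneg h6]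
      field_simp
    have he' : (ξ * (1 + N x)) • (L0.rcp (N x) • x) = ξ • x := by rw [smul_smul, he]
    have h1 := hr' (ξ * (1 + N x)) (by
      filter_upwards [hξ, L0.ae_mul ξ (1 + N x),
        L0.ae_add 1 (N x), L0.ae_one (P := P), N.nonneg x] with ω h1 h2 h3 h4 h5
      rw [h2, h3, h4, abs_mul, abs_of_nonneg (by positivity : 0 ≤ 1 + N x ω)]
      exact h1) (by rw [he']; exact h)
    have h2 : (⟨(ξ * (1 + N x)) • (L0.rcp (N x) • x), by rw [he']; exact h⟩ : N.L1Space) =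
        ⟨ξ • x, h⟩ := Subtype.ext he'
    rw [h2] at h1
    rw [h1]
    refine integral_congr_ae ?_
    filter_upwards [L0.ae_mul ξ (1 + N x), L0.ae_mul r (1 + N x)] with ω h3 h4
    rw [h3, h4]
    ring

end L0Seminorm

/-! ### Random functionals -/

namespace L0Seminorm

variable {Ω : Type*} [MeasurableSpace Ω] {P : Measure Ω} [IsProbabilityMeasure P]
  {E : Type*} [AddCommGroup E] [Module (L0 P ℝ) E]
  [Module ℝ E] [IsScalarTower ℝ (L0 P ℝ) E] (N : L0Seminorm P E)

/-- The random density of the continuous functional `f` at `x`, chosen from `exists_density`; it is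
unique by `L0.ae_eq_zero_of_forall_integral_mul`. -/
def densityAt (f : StrongDual ℝ N.L1Space) (x : E) : L0 P ℝ :=
  (N.exists_density f x).choose

theorem abs_densityAt_le (f : StrongDual ℝ N.L1Space) (x : E) :
    ∀ᵐ ω ∂P, |N.densityAt f x ω| ≤ ‖f‖ * N x ω :=
  (N.exists_density f x).choose_spec.1

theorem smul_mem_of_mul_le {ξ : L0 P ℝ} {x : E} (hξ : ∀ᵐ ω ∂P, |ξ ω| * (1 + N x ω) ≤ 1) :
    ξ • x ∈ N.L1Space := by
  refine N.mem_L1Space_of_ae_le (integrable_const (1 : ℝ)) ?_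
  filter_upwards [hξ, N.smul ξ x, N.nonneg x] with ω h1 h2 h3
  rw [h2]
  nlinarith [abs_nonneg (ξ ω)]

theorem apply_eq_integral_densityAt (f : StrongDual ℝ N.L1Space) {x : E} {ξ : L0 P ℝ}
    (hξ : ∀ᵐ ω ∂P, |ξ ω| * (1 + N x ω) ≤ 1) :
    f ⟨ξ • x, N.smul_mem_of_mul_le hξ⟩ = ∫ ω, ξ ω * N.densityAt f x ω ∂P :=
  (N.exists_density f x).choose_spec.2 ξ hξ _

theorem integrable_mul_densityAt (f : StrongDual ℝ N.L1Space) {x : E} {ξ : L0 P ℝ}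
    (hξ : ∀ᵐ ω ∂P, |ξ ω| * (1 + N x ω) ≤ 1) :
    Integrable (fun ω => ξ ω * N.densityAt f x ω) P := by
  refine L0.integrable_of_ae_abs_le (C := ‖f‖)
    (ξ.aestronglyMeasurable.mul (AEEqFun.aestronglyMeasurable _)) ?_
  filter_upwards [hξ, N.abs_densityAt_le f x, N.nonneg x] with ω h1 h2 h3
  rw [abs_mul]
  have h4 : |ξ ω| * N x ω ≤ 1 := by nlinarith [abs_nonneg (ξ ω)]
  calc |ξ ω| * |N.densityAt f x ω| ≤ |ξ ω| * (‖f‖ * N x ω) := by gcongr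
    _ = ‖f‖ * (|ξ ω| * N x ω) := by ring
    _ ≤ ‖f‖ * 1 := by gcongr
    _ = ‖f‖ := mul_one _

/-- Both sides have the same integrals against all multipliers that are small for `x`, `y` and
`x + y` at once. -/
theorem densityAt_add (f : StrongDual ℝ N.L1Space) (x y : E) :
    N.densityAt f (x + y) = N.densityAt f x + N.densityAt f y := by
  rw [← sub_eq_zero]
  refine L0.ae_eq_zero_of_forall_integral_mul _ (N x + N y + N (x + y)) fun ξ hξ => ?_
  have hu : ∀ᵐ ω ∂P, |ξ ω| * (1 + (N x ω + N y ω + N (x + y) ω)) ≤ 1 := by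
    filter_upwards [hξ, L0.ae_add (N x + N y) (N (x + y)), L0.ae_add (N x) (N y), N.nonneg x,
      N.nonneg y, N.nonneg (x + y)] with ω h1 h2 h3 h4 h5 h6
    rwa [h2, h3, abs_of_nonneg (a := _ + _ + _) (by positivity)] at h1
  have hx : ∀ᵐ ω ∂P, |ξ ω| * (1 + N x ω) ≤ 1 := by
    filter_upwards [hu, N.nonneg x, N.nonneg y, N.nonneg (x + y)] with ω h1 h2 h3 h4
    exact le_trans (mul_le_mul_of_nonneg_left (by linarith) (abs_nonneg _)) h1
  have hy : ∀ᵐ ω ∂P, |ξ ω| * (1 + N y ω) ≤ 1 := by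
    filter_upwards [hu, N.nonneg x, N.nonneg y, N.nonneg (x + y)] with ω h1 h2 h3 h4
    exact le_trans (mul_le_mul_of_nonneg_left (by linarith) (abs_nonneg _)) h1
  have hxy : ∀ᵐ ω ∂P, |ξ ω| * (1 + N (x + y) ω) ≤ 1 := by
    filter_upwards [hu, N.nonneg x, N.nonneg y, N.nonneg (x + y)] with ω h1 h2 h3 h4
    exact le_trans (mul_le_mul_of_nonneg_left (by linarith) (abs_nonneg _)) h1
  have h : f ⟨ξ • (x + y), N.smul_mem_of_mul_le hxy⟩ =
      f ⟨ξ • x, N.smul_mem_of_mul_le hx⟩ + f ⟨ξ • y, N.smul_mem_of_mul_le hy⟩ := by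
    rw [← map_add]
    congr 1
    exact Subtype.ext (smul_add ξ x y)
  have hadd : Integrable (fun ω => ξ ω * N.densityAt f x ω + ξ ω * N.densityAt f y ω) P :=
    (N.integrable_mul_densityAt f hx).add (N.integrable_mul_densityAt f hy)
  rw [apply_eq_integral_densityAt N f hxy, apply_eq_integral_densityAt N f hx,
    apply_eq_integral_densityAt N f hy, ← integral_add (N.integrable_mul_densityAt f hx)
      (N.integrable_mul_densityAt f hy), ← sub_eq_zero,
    ← integral_sub (N.integrable_mul_densityAt f hxy) hadd] at h
  rw [← h]
  refine integral_congr_ae ?_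
  filter_upwards [L0.ae_sub (N.densityAt f (x + y)) (N.densityAt f x + N.densityAt f y),
    L0.ae_add (N.densityAt f x) (N.densityAt f y)] with ω h1 h2
  rw [h1, h2]
  ring

/-- Both sides have the same integrals against all multipliers `ξ` that are small for `η • x` and for
which `ξ η` is small for `x`. -/
theorem densityAt_smul (f : StrongDual ℝ N.L1Space) (η : L0 P ℝ) (x : E) :
    N.densityAt f (η • x) = η * N.densityAt f x := by
  rw [← sub_eq_zero]
  refine L0.ae_eq_zero_of_forall_integral_mul _ (N (η • x) + |η| * (1 + N x)) fun ξ hξ => ?_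
  have hu : ∀ᵐ ω ∂P, |ξ ω| * (1 + (N (η • x) ω + |η ω| * (1 + N x ω))) ≤ 1 := by
    filter_upwards [hξ, L0.ae_add (N (η • x)) (|η| * (1 + N x)), L0.ae_mul |η| (1 + N x),
      L0.ae_add 1 (N x), L0.ae_one (P := P), AEEqFun.coeFn_abs η, N.nonneg x,
      N.nonneg (η • x)] with ω h1 h2 h3 h4 h5 h6 h7 h8
    rwa [h2, h3, h4, h5, h6, abs_of_nonneg (a := _ + _ * _) (by positivity)] at h1
  have hx : ∀ᵐ ω ∂P, |(ξ * η) ω| * (1 + N x ω) ≤ 1 := by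
    filter_upwards [hu, L0.ae_mul ξ η, N.nonneg (η • x)] with ω h1 h2 h3
    rw [h2, abs_mul, mul_assoc]
    exact le_trans (mul_le_mul_of_nonneg_left (by linarith) (abs_nonneg _)) h1
  have hy : ∀ᵐ ω ∂P, |ξ ω| * (1 + N (η • x) ω) ≤ 1 := by
    filter_upwards [hu, N.nonneg x] with ω h1 h2
    refine le_trans (mul_le_mul_of_nonneg_left ?_ (abs_nonneg _)) h1
    have : 0 ≤ |η ω| * (1 + N x ω) := by positivity
    linarith
  have h : f ⟨ξ • (η • x), N.smul_mem_of_mul_le hy⟩ =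
      f ⟨(ξ * η) • x, N.smul_mem_of_mul_le hx⟩ := by
    congr 1
    exact Subtype.ext (smul_smul ξ η x)
  rw [apply_eq_integral_densityAt N f hy, apply_eq_integral_densityAt N f hx, ← sub_eq_zero,
    ← integral_sub (N.integrable_mul_densityAt f hy) (N.integrable_mul_densityAt f hx)] at h
  rw [← h]
  refine integral_congr_ae ?_
  filter_upwards [L0.ae_sub (N.densityAt f (η • x)) (η * N.densityAt f x),
    L0.ae_mul η (N.densityAt f x), L0.ae_mul ξ η] with ω h1 h2 h3
  rw [h1, h2, h3]
  ring

/-- The random functional represented by a continuous functional on `N.L1Space`: an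
`L⁰`-linear map on the whole of `E`. -/
def density (f : StrongDual ℝ N.L1Space) : E →ₗ[L0 P ℝ] L0 P ℝ where
  toFun := N.densityAt f
  map_add' := N.densityAt_add f
  map_smul' := N.densityAt_smul f

theorem abs_density_le (f : StrongDual ℝ N.L1Space) (x : E) :
    ∀ᵐ ω ∂P, |N.density f x ω| ≤ ‖f‖ * N x ω :=
  N.abs_densityAt_le f x

theorem density_add (f g : StrongDual ℝ N.L1Space) (x : E) :
    N.density (f + g) x = N.density f x + N.density g x := by
  rw [← sub_eq_zero]
  refine L0.ae_eq_zero_of_forall_integral_mul _ (N x) fun ξ hξ => ?_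
  have hx : ∀ᵐ ω ∂P, |ξ ω| * (1 + N x ω) ≤ 1 := by
    filter_upwards [hξ, N.nonneg x] with ω h1 h2
    rwa [abs_of_nonneg h2] at h1
  have h : (f + g) ⟨ξ • x, N.smul_mem_of_mul_le hx⟩ =
      f ⟨ξ • x, N.smul_mem_of_mul_le hx⟩ + g ⟨ξ • x, N.smul_mem_of_mul_le hx⟩ := rfl
  have hadd : Integrable (fun ω => ξ ω * N.densityAt f x ω + ξ ω * N.densityAt g x ω) P :=
    (N.integrable_mul_densityAt f hx).add (N.integrable_mul_densityAt g hx)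
  rw [apply_eq_integral_densityAt N _ hx, apply_eq_integral_densityAt N _ hx,
    apply_eq_integral_densityAt N _ hx, ← integral_add (N.integrable_mul_densityAt f hx)
      (N.integrable_mul_densityAt g hx), ← sub_eq_zero,
    ← integral_sub (N.integrable_mul_densityAt _ hx) hadd] at h
  rw [← h]
  refine integral_congr_ae ?_
  filter_upwards [L0.ae_sub (N.density (f + g) x) (N.density f x + N.density g x),
    L0.ae_add (N.density f x) (N.density g x)] with ω h1 h2
  rw [h1, h2]
  change _ = ξ ω * N.density (f + g) x ω - (ξ ω * N.density f x ω + ξ ω * N.density g x ω)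
  ring

theorem density_sub (f g : StrongDual ℝ N.L1Space) (x : E) :
    N.density (f - g) x = N.density f x - N.density g x := by
  rw [eq_sub_iff_add_eq, ← density_add, sub_add_cancel]

theorem density_smul (r : ℝ) (f : StrongDual ℝ N.L1Space) (x : E) :
    N.density (r • f) x = r • N.density f x := by
  rw [← sub_eq_zero]
  refine L0.ae_eq_zero_of_forall_integral_mul _ (N x) fun ξ hξ => ?_
  have hx : ∀ᵐ ω ∂P, |ξ ω| * (1 + N x ω) ≤ 1 := by
    filter_upwards [hξ, N.nonneg x] with ω h1 h2
    rwa [abs_of_nonneg h2] at h1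
  have h : (r • f) ⟨ξ • x, N.smul_mem_of_mul_le hx⟩ =
      r * f ⟨ξ • x, N.smul_mem_of_mul_le hx⟩ := rfl
  rw [apply_eq_integral_densityAt N _ hx, apply_eq_integral_densityAt N _ hx,
    ← integral_const_mul, ← sub_eq_zero,
    ← integral_sub (N.integrable_mul_densityAt _ hx)
      ((N.integrable_mul_densityAt f hx).const_mul r)] at h
  rw [← h]
  refine integral_congr_ae ?_
  filter_upwards [L0.ae_sub (N.density (r • f) x) (r • N.density f x),
    L0.ae_smul r (N.density f x)] with ω h1 h2
  rw [h1, h2]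
  change _ = ξ ω * N.density (r • f) x ω - r * (ξ ω * N.density f x ω)
  ring

/-- On the elements of bounded seminorm, `f` is the expectation of its random density. -/
theorem apply_eq_integral_density (f : StrongDual ℝ N.L1Space) {x : E}
    (hx : ∀ᵐ ω ∂P, N x ω ≤ 1) (hm : x ∈ N.L1Space) :
    f ⟨x, hm⟩ = ∫ ω, N.density f x ω ∂P := by
  -- the constant multiplier `1 / 2` satisfies the bound required of multipliers
  have hc : ∀ᵐ ω ∂P, ((1 / 2 : ℝ) • (1 : L0 P ℝ)) ω = 1 / 2 := by
    filter_upwards [L0.ae_smul (1 / 2) (1 : L0 P ℝ), L0.ae_one (P := P)] with ω h1 h2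
    rw [h1, h2, mul_one]
  have hξ : ∀ᵐ ω ∂P, |((1 / 2 : ℝ) • (1 : L0 P ℝ)) ω| * (1 + N x ω) ≤ 1 := by
    filter_upwards [hc, hx] with ω h1 h2
    rw [h1, abs_of_pos (by norm_num)]
    linarith
  have h1 := N.apply_eq_integral_densityAt f hξ
  have h2 : (⟨((1 / 2 : ℝ) • (1 : L0 P ℝ)) • x, N.smul_mem_of_mul_le hξ⟩ : N.L1Space) =
      (1 / 2 : ℝ) • ⟨x, hm⟩ := by
    apply Subtype.ext
    change ((1 / 2 : ℝ) • (1 : L0 P ℝ)) • x = (1 / 2 : ℝ) • x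
    rw [smul_assoc, one_smul]
  have h3 : ∫ ω, ((1 / 2 : ℝ) • (1 : L0 P ℝ)) ω * N.densityAt f x ω ∂P =
      1 / 2 * ∫ ω, N.density f x ω ∂P := by
    rw [← integral_const_mul]
    refine integral_congr_ae ?_
    filter_upwards [hc] with ω h
    rw [h]
    rfl
  rw [h2, map_smul, h3, smul_eq_mul] at h1
  linarith

/-- Random Hahn–Banach: every `x : E` is normed by the density of a functional in the unit
ball. -/
theorem exists_density_eq (x : E) : ∃ f : StrongDual ℝ N.L1Space, ‖f‖ ≤ 1 ∧
    N.density f x = N x := by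
  let z := L0.rcp (N x) • x
  have hz : ∀ᵐ ω ∂P, N z ω ≤ 1 := N.rcp_smul_le_one x
  have hm : z ∈ N.L1Space := N.mem_L1Space_of_ae_le (integrable_const (1 : ℝ)) hz
  obtain ⟨f, hf1, hf2⟩ := exists_dual_vector'' ℝ (⟨z, hm⟩ : N.L1Space)
  refine ⟨f, hf1, ?_⟩
  rw [N.apply_eq_integral_density f hz hm, norm_def] at hf2
  have hle : ∀ᵐ ω ∂P, |N.density f z ω| ≤ N z ω := by
    filter_upwards [N.abs_density_le f z, N.nonneg z] with ω h1 h2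
    exact h1.trans (mul_le_of_le_one_left h2 hf1)
  have hdi : Integrable (N.density f z) P := by
    refine Integrable.mono' hm (AEEqFun.aestronglyMeasurable _) ?_
    filter_upwards [hle] with ω h
    exact h
  have heq : (N.density f z : Ω → ℝ) =ᵐ[P] N z := by
    refine (integral_eq_iff_of_ae_le hdi hm ?_).1 hf2
    filter_upwards [hle] with ω h
    exact (le_abs_self _).trans h
  apply AEEqFun.ext
  have h0 : N.density f z = L0.rcp (N x) * N.density f x := (N.density f).map_smul _ _
  rw [h0] at heq
  filter_upwards [heq, L0.ae_mul (L0.rcp (N x)) (N.density f x), N.smul (L0.rcp (N x)) x,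
    L0.coeFn_rcp (N x)] with ω h1 h2 h3 h4
  have hpos : 0 < L0.rcp (N x) ω := by rw [h4]; positivity
  change _ = N z ω at h1
  rw [h2, h3, abs_of_pos hpos] at h1
  exact mul_left_cancel₀ hpos.ne' h1

end L0Seminorm

/-! ### Concatenation and attained minima -/

section Concatenation

variable {Ω : Type*} [MeasurableSpace Ω] {P : Measure Ω}
  {E : Type*} [AddCommGroup E] [Module (L0 P ℝ) E]

/-- `L⁰`-convexity in a module over the real algebra `L⁰(𝓕, ℝ)`. -/
def RealL0Convex (P : Measure Ω) {E : Type*} [AddCommGroup E] [Module (L0 P ℝ) E]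
    (G : Set E) : Prop :=
  ∀ x ∈ G, ∀ y ∈ G, ∀ ξ : L0 P ℝ, 0 ≤ ξ → ξ ≤ 1 → ξ • x + (1 - ξ) • y ∈ G

theorem RealL0Convex.inter {G H : Set E} (hG : RealL0Convex P G) (hH : RealL0Convex P H) :
    RealL0Convex P (G ∩ H) :=
  fun x hx y hy ξ h0 h1 => ⟨hG x hx.1 y hy.1 ξ h0 h1, hH x hx.2 y hy.2 ξ h0 h1⟩

variable (P) in
/-- The concatenation of `x` on `B` and `y` off `B`. -/
def L0.concat (B : Set Ω) (hB : MeasurableSet B) (x y : E) : E :=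
  (L0.ind B hB : L0 P ℝ) • x + (1 - L0.ind B hB : L0 P ℝ) • y

/-- The map `u` is local: its value at the concatenation of `x` on `B` and `y` off `B` is the
concatenation of its values at `x` and at `y`. -/
def IsLocalMap (u : E → L0 P ℝ) : Prop :=
  ∀ (x y : E) (B : Set Ω) (hB : MeasurableSet B), ∀ᵐ ω ∂P,
    (ω ∈ B → u (L0.concat P B hB x y) ω = u x ω) ∧
    (ω ∉ B → u (L0.concat P B hB x y) ω = u y ω)

theorem IsLocalMap.neg {u : E → L0 P ℝ} (hu : IsLocalMap u) : IsLocalMap fun x => -u x := by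
  intro x y B hB
  filter_upwards [hu x y B hB, L0.ae_neg (u x), L0.ae_neg (u y),
    L0.ae_neg (u (L0.concat P B hB x y))] with ω h1 h2 h3 h4
  rw [h2, h3, h4]
  exact ⟨fun h => by rw [h1.1 h], fun h => by rw [h1.2 h]⟩

theorem L0.ind_smul_concat_left (x y : E) (B : Set Ω) (hB : MeasurableSet B) :
    (L0.ind B hB : L0 P ℝ) • L0.concat P B hB x y =
      (L0.ind B hB : L0 P ℝ) • x := by
  have h : (L0.ind B hB : L0 P ℝ) * L0.ind B hB = L0.ind B hB := by
    apply AEEqFun.ext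
    filter_upwards [L0.ae_mul (L0.ind B hB : L0 P ℝ) (L0.ind B hB), L0.coeFn_ind (P := P) B hB]
      with ω h1 h2
    rw [h1, h2]
    by_cases hω : ω ∈ B <;> simp [hω]
  rw [L0.concat, smul_add, smul_smul, smul_smul, mul_sub, mul_one, h, sub_self, zero_smul, add_zero]

theorem L0.ind_smul_concat_right (x y : E) (B : Set Ω) (hB : MeasurableSet B) :
    (1 - L0.ind B hB : L0 P ℝ) • L0.concat P B hB x y =
      (1 - L0.ind B hB : L0 P ℝ) • y := by
  rw [sub_smul, L0.ind_smul_concat_left, one_smul, L0.concat, add_sub_cancel_left]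

/-- The seminorm of `x` on `B` only depends on `1_B x`. -/
theorem L0Seminorm.isLocalMap (N : L0Seminorm P E) : IsLocalMap N := by
  intro x y B hB
  have hl := L0.ind_smul_concat_left (P := P) x y B hB
  have hr := L0.ind_smul_concat_right (P := P) x y B hB
  set w := L0.concat P B hB x y
  have h1 := N.smul (L0.ind B hB) w
  have h2 := N.smul (1 - L0.ind B hB) w
  rw [hl] at h1
  rw [hr] at h2
  filter_upwards [h1, h2, N.smul (L0.ind B hB) x, N.smul (1 - L0.ind B hB) y,
    L0.coeFn_ind (P := P) B hB, L0.ae_sub (1 : L0 P ℝ) (L0.ind B hB), L0.ae_one (P := P)]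
    with ω h1 h2 h3 h4 h5 h6 h7
  rw [h3, h5] at h1
  rw [h4, h6, h7, h5] at h2
  constructor
  · intro hω
    simpa [hω] using h1.symm
  · intro hω
    simpa [hω] using h2.symm

/-- The values of an `L⁰`-linear map on `L⁰`-convex combinations, almost surely. -/
theorem LinearMap.ae_smul_add_smul (g : E →ₗ[L0 P ℝ] L0 P ℝ) (ξ : L0 P ℝ) (x y : E) :
    ∀ᵐ ω ∂P, g (ξ • x + (1 - ξ) • y) ω = ξ ω * g x ω + (1 - ξ ω) * g y ω := by
  rw [map_add, map_smul, map_smul, smul_eq_mul, smul_eq_mul]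
  filter_upwards [L0.ae_add (ξ * g x) ((1 - ξ) * g y), L0.ae_mul ξ (g x),
    L0.ae_mul (1 - ξ) (g y), L0.ae_sub 1 ξ, L0.ae_one (P := P)] with ω h1 h2 h3 h4 h5
  rw [h1, h2, h3, h4, h5]

theorem LinearMap.isLocalMap (g : E →ₗ[L0 P ℝ] L0 P ℝ) : IsLocalMap g := by
  intro x y B hB
  filter_upwards [g.ae_smul_add_smul (L0.ind B hB) x y, L0.coeFn_ind (P := P) B hB] with ω h1 h2
  rw [L0.concat, h1, h2]
  exact ⟨fun h => by simp [h], fun h => by simp [h]⟩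

/-- In an `L⁰`-convex set, a local map has values below the values at two given points. -/
theorem IsLocalMap.exists_le_le {u : E → L0 P ℝ} (hu : IsLocalMap u) {G : Set E}
    (hG : RealL0Convex P G) {x y : E} (hx : x ∈ G) (hy : y ∈ G) :
    ∃ w ∈ G, u w ≤ u x ∧ u w ≤ u y := by
  have hB : MeasurableSet {ω | u x ω ≤ u y ω} :=
    measurableSet_le (AEEqFun.measurable _) (AEEqFun.measurable _)
  have h01 : ∀ᵐ ω ∂P, 0 ≤ (L0.ind _ hB : L0 P ℝ) ω ∧ (L0.ind _ hB : L0 P ℝ) ω ≤ 1 := by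
    filter_upwards [L0.coeFn_ind (P := P) _ hB] with ω h
    rw [h]
    by_cases hω : ω ∈ {ω | u x ω ≤ u y ω} <;> simp [hω, indicator]
  refine ⟨L0.concat P _ hB x y, hG x hx y hy _ ?_ ?_, ?_, ?_⟩
  · rw [L0.le_iff]
    filter_upwards [h01, L0.ae_zero (P := P)] with ω h h'
    rw [h']
    exact h.1
  · rw [L0.le_iff]
    filter_upwards [h01, L0.ae_one (P := P)] with ω h h'
    rw [h']
    exact h.2
  · rw [L0.le_iff]
    filter_upwards [hu x y _ hB] with ω h
    by_cases hω : u x ω ≤ u y ω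
    · exact (h.1 hω).le
    · rw [h.2 hω]
      exact (not_le.1 hω).le
  · rw [L0.le_iff]
    filter_upwards [hu x y _ hB] with ω h
    by_cases hω : u x ω ≤ u y ω
    · rw [h.1 hω]
      exact hω
    · exact (h.2 hω).le

/-- A local map whose sublevel sets are closed and `L⁰`-convex attains, on a nonempty
`L⁰`-convexly compact set, a minimum for the almost sure order. -/
theorem IsLocalMap.exists_forall_le {u : E → L0 P ℝ} (hu : IsLocalMap u) {t : TopologicalSpace E}
    {G : Set E} (hG : RealL0Convex P G) (hc : IsFIPCompact t (RealL0Convex P) G)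
    (hne : G.Nonempty) (hconv : ∀ c, RealL0Convex P {x | u x ≤ c})
    (hclosed : ∀ c, IsClosed[t] {x | u x ≤ c}) :
    ∃ x ∈ G, ∀ y ∈ G, u x ≤ u y := by
  obtain ⟨y₀, hy₀⟩ := hne
  -- the sets `{x ∈ G | u x ≤ u y}` have the finite intersection property by concatenation
  let 𝓕 : Set (Set E) := (fun y => G ∩ {x | u x ≤ u y}) '' G
  have hfin : ∀ 𝓢 : Set (Set E), 𝓢.Finite → 𝓢 ⊆ 𝓕 → ∃ z ∈ G, ∀ F ∈ 𝓢, z ∈ F := by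
    intro 𝓢 h𝓢
    induction 𝓢, h𝓢 using Set.Finite.induction_on with
    | empty => exact fun _ => ⟨y₀, hy₀, fun F hF => absurd hF (notMem_empty F)⟩
    | @insert F 𝓢 _ _ ih =>
      intro hsub
      obtain ⟨z, hz, hzF⟩ := ih ((subset_insert _ _).trans hsub)
      obtain ⟨y, hy, rfl⟩ := hsub (mem_insert _ _)
      obtain ⟨w, hw, hwz, hwy⟩ := hu.exists_le_le hG hz hy
      refine ⟨w, hw, ?_⟩
      rintro F' (rfl | hF')
      · exact ⟨hw, hwy⟩
      · obtain ⟨y', _, rfl⟩ := hsub (mem_insert_of_mem _ hF')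
        exact ⟨hw, hwz.trans (hzF _ hF').2⟩
  obtain ⟨x, hx⟩ := hc 𝓕 ⟨_, mem_image_of_mem _ hy₀⟩
    (by
      rintro _ ⟨y, _, rfl⟩
      exact ⟨hG.inter (hconv _), _, hclosed _, rfl⟩)
    (fun 𝓢 hsub hf _ => by
      obtain ⟨z, _, hz⟩ := hfin 𝓢 hf hsub
      exact ⟨z, hz⟩)
  exact ⟨x, (hx _ (mem_image_of_mem _ hy₀)).1, fun y hy => (hx _ (mem_image_of_mem _ hy)).2⟩

end Concatenation

section Topology

variable {Ω : Type*} [MeasurableSpace Ω] {P : Measure Ω}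
  {E : Type*} [AddCommGroup E] [Module (L0 P ℝ) E] {κ : Type*}

/-- The properties of the `(ε, λ)`-topology of a directed family of `L⁰`-seminorms on which the
argument relies: sets that are closed under almost sure convergence for one of the seminorms are
closed, and closed sets are separated, in probability and for one of the seminorms, from each
point of their complement. -/
structure IsEpsilonLambda (t : TopologicalSpace E) (N : κ → L0Seminorm P E) : Prop where
  nonempty : Nonempty κ
  directed : ∀ a b, ∃ c, (∀ x, N a x ≤ N c x) ∧ ∀ x, N b x ≤ N c x
  isClosed_of_ae_tendsto : ∀ (Z : Set E) (a : κ), (∀ (x : E) (z : ℕ → E), (∀ n, z n ∈ Z) →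
    (∀ᵐ ω ∂P, Tendsto (fun n => N a (z n - x) ω) atTop (𝓝 0)) → x ∈ Z) → IsClosed[t] Z
  exists_le_measureReal : ∀ Z : Set E, IsClosed[t] Z → ∀ x ∉ Z, ∃ (a : κ) (ε δ : ℝ), 0 < ε ∧ 0 < δ ∧
    ∀ z ∈ Z, δ ≤ P.real {ω | ε ≤ N a (z - x) ω}

/-- The random functional `g` is dominated by a multiple of one of the `L⁰`-seminorms. -/
def IsDominated (N : κ → L0Seminorm P E) (g : E →ₗ[L0 P ℝ] L0 P ℝ) : Prop :=
  ∃ (a : κ) (C : L0 P ℝ), ∀ x, ∀ᵐ ω ∂P, |g x ω| ≤ |C ω| * N a x ω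

theorem IsDominated.smul {N : κ → L0Seminorm P E} {g : E →ₗ[L0 P ℝ] L0 P ℝ}
    (hg : IsDominated N g) (ξ : L0 P ℝ) : IsDominated N (ξ • g) := by
  obtain ⟨a, C, h⟩ := hg
  refine ⟨a, ξ * C, fun x => ?_⟩
  rw [LinearMap.smul_apply, smul_eq_mul]
  filter_upwards [h x, L0.ae_mul ξ C, L0.ae_mul ξ (g x)] with ω h1 h2 h3
  rw [h2, h3, abs_mul, abs_mul, mul_assoc]
  gcongr

variable {t : TopologicalSpace E} {N : κ → L0Seminorm P E}

/-- Finitely many dominated functionals are dominated by multiples of one common seminorm. -/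
theorem IsEpsilonLambda.exists_common (ht : IsEpsilonLambda t N) {J : Type*} (s : Finset J)
    (g : J → E →ₗ[L0 P ℝ] L0 P ℝ) (hg : ∀ j ∈ s, IsDominated N (g j)) :
    ∃ a, ∀ j ∈ s, ∃ C : L0 P ℝ, ∀ x, ∀ᵐ ω ∂P, |g j x ω| ≤ |C ω| * N a x ω := by
  classical
  induction s using Finset.induction_on with
  | empty => exact ⟨ht.nonempty.some, fun j hj => absurd hj (Finset.notMem_empty j)⟩
  | insert i s _ ih =>
    obtain ⟨a, ha⟩ := ih fun j hj => hg j (Finset.mem_insert_of_mem hj)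
    obtain ⟨b, C, hC⟩ := hg i (Finset.mem_insert_self i s)
    obtain ⟨c, hac, hbc⟩ := ht.directed a b
    refine ⟨c, fun j hj => ?_⟩
    rcases Finset.mem_insert.1 hj with rfl | hj
    · refine ⟨C, fun x => ?_⟩
      filter_upwards [hC x, L0.le_iff.1 (hbc x)] with ω h1 h2
      exact h1.trans (by gcongr)
    · obtain ⟨D, hD⟩ := ha j hj
      refine ⟨D, fun x => ?_⟩
      filter_upwards [hD x, L0.le_iff.1 (hac x)] with ω h1 h2
      exact h1.trans (by gcongr)

/-- Dominated random functionals are continuous for almost sure convergence. -/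
theorem ae_tendsto_of_dominated {M : L0Seminorm P E} {g : E →ₗ[L0 P ℝ] L0 P ℝ}
    {C : L0 P ℝ} (hC : ∀ x, ∀ᵐ ω ∂P, |g x ω| ≤ |C ω| * M x ω) {x : E} {z : ℕ → E}
    (hz : ∀ᵐ ω ∂P, Tendsto (fun n => M (z n - x) ω) atTop (𝓝 0)) :
    ∀ᵐ ω ∂P, Tendsto (fun n => g (z n) ω) atTop (𝓝 (g x ω)) := by
  have h1 : ∀ᵐ ω ∂P, ∀ n, |g (z n - x) ω| ≤ |C ω| * M (z n - x) ω :=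
    ae_all_iff.2 fun n => hC _
  have h2 : ∀ᵐ ω ∂P, ∀ n, g (z n - x) ω = g (z n) ω - g x ω := by
    refine ae_all_iff.2 fun n => ?_
    rw [map_sub]
    exact L0.ae_sub _ _
  filter_upwards [hz, h1, h2] with ω h1 h2 h3
  rw [tendsto_iff_norm_sub_tendsto_zero]
  refine squeeze_zero (fun _ => norm_nonneg _) (fun n => ?_) (by simpa using h1.const_mul |C ω|)
  rw [Real.norm_eq_abs, ← h3 n]
  exact h2 n

/-- The random sum of squares `∑ (g j x - γ j)²`. -/
def sumSq {J : Type*} (s : Finset J) (g : J → E →ₗ[L0 P ℝ] L0 P ℝ) (γ : J → L0 P ℝ) (x : E) :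
    L0 P ℝ :=
  ∑ j ∈ s, (g j x - γ j) * (g j x - γ j)

theorem ae_sumSq {J : Type*} (s : Finset J) (g : J → E →ₗ[L0 P ℝ] L0 P ℝ) (γ : J → L0 P ℝ)
    (x : E) : ∀ᵐ ω ∂P, sumSq s g γ x ω = ∑ j ∈ s, (g j x ω - γ j ω) ^ 2 := by
  have h2 : ∀ᵐ ω ∂P, ∀ j ∈ s, ((g j x - γ j) * (g j x - γ j)) ω = (g j x ω - γ j ω) ^ 2 := by
    refine (Finset.eventually_all s).2 fun j _ => ?_
    filter_upwards [L0.ae_mul (g j x - γ j) (g j x - γ j), L0.ae_sub (g j x) (γ j)] with ω h1 h2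
    rw [h1, h2, sq]
  have h1 := AEEqFun.coeFn_fun_finsetSum s (fun j => (g j x - γ j) * (g j x - γ j))
  filter_upwards [h1, h2] with ω h3 h4
  exact h3.trans (Finset.sum_congr rfl h4)

theorem isLocalMap_sumSq {J : Type*} (s : Finset J) (g : J → E →ₗ[L0 P ℝ] L0 P ℝ)
    (γ : J → L0 P ℝ) : IsLocalMap (sumSq s g γ) := by
  intro x y B hB
  have h : ∀ᵐ ω ∂P, ∀ j ∈ s, _ := (Finset.eventually_all s).2 fun j _ => (g j).isLocalMap x y B hB
  filter_upwards [ae_sumSq s g γ x, ae_sumSq s g γ y,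
    ae_sumSq s g γ (L0.concat P B hB x y), h] with ω h1 h2 h3 h4
  rw [h1, h2, h3]
  exact ⟨fun hω => Finset.sum_congr rfl fun j hj => by rw [(h4 j hj).1 hω],
    fun hω => Finset.sum_congr rfl fun j hj => by rw [(h4 j hj).2 hω]⟩

theorem realL0Convex_sumSq_le {J : Type*} (s : Finset J) (g : J → E →ₗ[L0 P ℝ] L0 P ℝ)
    (γ : J → L0 P ℝ) (c : L0 P ℝ) : RealL0Convex P {x | sumSq s g γ x ≤ c} := by
  intro x hx y hy ξ h0 h1
  have h : ∀ᵐ ω ∂P, ∀ j ∈ s, _ := (Finset.eventually_all s).2 fun j _ => (g j).ae_smul_add_smul ξ x y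
  change _ ≤ c
  rw [L0.le_iff] at h0 h1 ⊢
  filter_upwards [ae_sumSq s g γ x, ae_sumSq s g γ y, ae_sumSq s g γ (ξ • x + (1 - ξ) • y), h,
    h0, h1, L0.ae_zero (P := P), L0.ae_one (P := P), L0.le_iff.1 hx, L0.le_iff.1 hy]
    with ω h1 h2 h3 h4 h5 h6 h7 h8 h9 h10
  rw [h7] at h5
  rw [h8] at h6
  rw [h3]
  rw [h1] at h9
  rw [h2] at h10
  calc ∑ j ∈ s, (g j (ξ • x + (1 - ξ) • y) ω - γ j ω) ^ 2
      ≤ ∑ j ∈ s, (ξ ω * (g j x ω - γ j ω) ^ 2 + (1 - ξ ω) * (g j y ω - γ j ω) ^ 2) := by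
        refine Finset.sum_le_sum fun j hj => ?_
        rw [h4 j hj]
        nlinarith [mul_nonneg (mul_nonneg h5 (sub_nonneg.2 h6)) (sq_nonneg (g j x ω - g j y ω))]
    _ = ξ ω * ∑ j ∈ s, (g j x ω - γ j ω) ^ 2 +
        (1 - ξ ω) * ∑ j ∈ s, (g j y ω - γ j ω) ^ 2 := by
        rw [Finset.sum_add_distrib, Finset.mul_sum, Finset.mul_sum]
    _ ≤ ξ ω * c ω + (1 - ξ ω) * c ω := by
        gcongr
    _ = c ω := by ring

theorem IsEpsilonLambda.isClosed_sumSq_le (ht : IsEpsilonLambda t N) {J : Type*} (s : Finset J)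
    (g : J → E →ₗ[L0 P ℝ] L0 P ℝ) (hg : ∀ j ∈ s, IsDominated N (g j)) (γ : J → L0 P ℝ)
    (c : L0 P ℝ) : IsClosed[t] {x | sumSq s g γ x ≤ c} := by
  obtain ⟨a, ha⟩ := ht.exists_common s g hg
  refine ht.isClosed_of_ae_tendsto _ a fun x z hz hlim => ?_
  have h1 : ∀ᵐ ω ∂P, ∀ j ∈ s, Tendsto (fun n => g j (z n) ω) atTop (𝓝 (g j x ω)) := by
    refine (Finset.eventually_all s).2 fun j hj => ?_
    obtain ⟨C, hC⟩ := ha j hj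
    exact ae_tendsto_of_dominated hC hlim
  have h2 : ∀ᵐ ω ∂P, ∀ n, sumSq s g γ (z n) ω ≤ c ω :=
    ae_all_iff.2 fun n => L0.le_iff.1 (hz n)
  have h3 : ∀ᵐ ω ∂P, ∀ n, sumSq s g γ (z n) ω = ∑ j ∈ s, (g j (z n) ω - γ j ω) ^ 2 :=
    ae_all_iff.2 fun n => ae_sumSq s g γ (z n)
  change _ ≤ c
  rw [L0.le_iff]
  filter_upwards [h1, h2, h3, ae_sumSq s g γ x] with ω h1 h2 h3 h4
  rw [h4]
  refine le_of_tendsto (tendsto_finsetSum s fun j hj => ((h1 j hj).sub_const (γ j ω)).pow 2)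
    (Eventually.of_forall fun n => ?_)
  rw [← h3 n]
  exact h2 n

theorem IsEpsilonLambda.isClosed_le (ht : IsEpsilonLambda t N)
    {g : E →ₗ[L0 P ℝ] L0 P ℝ} (hg : IsDominated N g) (c : L0 P ℝ) :
    IsClosed[t] {x | g x ≤ c} := by
  obtain ⟨a, C, hC⟩ := hg
  refine ht.isClosed_of_ae_tendsto _ a fun x z hz hlim => ?_
  change _ ≤ c
  rw [L0.le_iff]
  have h2 : ∀ᵐ ω ∂P, ∀ n, g (z n) ω ≤ c ω := ae_all_iff.2 fun n => L0.le_iff.1 (hz n)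
  filter_upwards [ae_tendsto_of_dominated hC hlim, h2] with ω h1 h2
  exact le_of_tendsto' h1 h2

theorem IsEpsilonLambda.isClosed_eq (ht : IsEpsilonLambda t N)
    {g : E →ₗ[L0 P ℝ] L0 P ℝ} (hg : IsDominated N g) (c : L0 P ℝ) :
    IsClosed[t] {x | g x = c} := by
  obtain ⟨a, C, hC⟩ := hg
  refine ht.isClosed_of_ae_tendsto _ a fun x z hz hlim => ?_
  change g x = c
  apply AEEqFun.ext
  have h2 : ∀ᵐ ω ∂P, ∀ n, g (z n) ω = c ω :=
    ae_all_iff.2 fun n => by rw [hz n]; exact Eventually.of_forall fun _ => rfl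
  filter_upwards [ae_tendsto_of_dominated hC hlim, h2] with ω h1 h2
  simp only [h2] at h1
  exact (tendsto_nhds_unique h1 tendsto_const_nhds)

theorem realL0Convex_le (g : E →ₗ[L0 P ℝ] L0 P ℝ) (c : L0 P ℝ) :
    RealL0Convex P {x | g x ≤ c} := by
  intro x hx y hy ξ h0 h1
  change _ ≤ c
  rw [L0.le_iff] at h0 h1 ⊢
  filter_upwards [g.ae_smul_add_smul ξ x y, h0, h1, L0.ae_zero (P := P), L0.ae_one (P := P),
    L0.le_iff.1 hx, L0.le_iff.1 hy] with ω h1 h2 h3 h4 h5 h6 h7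
  rw [h4] at h2
  rw [h5] at h3
  rw [h1]
  nlinarith

theorem realL0Convex_eq (g : E →ₗ[L0 P ℝ] L0 P ℝ) (c : L0 P ℝ) :
    RealL0Convex P {x | g x = c} := by
  intro x hx y hy ξ _ _
  change g _ = c
  rw [map_add, map_smul, map_smul, hx, hy, smul_eq_mul, smul_eq_mul]
  ring

/-- On an `L⁰`-convexly compact set, a dominated random functional is bounded by an element
of `L⁰`. -/
theorem IsEpsilonLambda.exists_forall_abs_le (ht : IsEpsilonLambda t N) {G : Set E}
    (hG : RealL0Convex P G) (hc : IsFIPCompact t (RealL0Convex P) G)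
    {g : E →ₗ[L0 P ℝ] L0 P ℝ} (hg : IsDominated N g) :
    ∃ m : L0 P ℝ, ∀ y ∈ G, ∀ᵐ ω ∂P, |g y ω| ≤ m ω := by
  rcases G.eq_empty_or_nonempty with rfl | hne
  · exact ⟨0, fun y hy => hy.elim⟩
  have hneg : IsDominated N (-g) := by
    have := hg.smul (-1 : L0 P ℝ)
    rwa [neg_one_smul] at this
  obtain ⟨x, _, hx⟩ := g.isLocalMap.exists_forall_le hG hc hne (realL0Convex_le g)
    (ht.isClosed_le hg)
  obtain ⟨x', _, hx'⟩ := (-g).isLocalMap.exists_forall_le hG hc hne (realL0Convex_le (-g))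
    (ht.isClosed_le hneg)
  have hm : ∀ᵐ ω ∂P, (|g x| + |g x'|) ω = |g x ω| + |g x' ω| := by
    filter_upwards [L0.ae_add |g x| |g x'|, AEEqFun.coeFn_abs (g x), AEEqFun.coeFn_abs (g x')]
      with ω h1 h2 h3
    rw [h1, h2, h3]
  refine ⟨|g x| + |g x'|, fun y hy => ?_⟩
  filter_upwards [hm, L0.le_iff.1 (hx y hy), L0.le_iff.1 (hx' y hy), L0.ae_neg (g x'),
    L0.ae_neg (g y)] with ω h1 h2 h3 h4 h5
  rw [LinearMap.neg_apply, LinearMap.neg_apply, h4, h5] at h3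
  rw [h1, abs_le]
  constructor
  · linarith [neg_abs_le (g x ω), neg_abs_le (g x' ω), abs_nonneg (g x' ω), le_abs_self (g x ω)]
  · linarith [le_abs_self (g x' ω), neg_abs_le (g x' ω), abs_nonneg (g x ω)]

end Topology

/-! ### Boundedness on convexly compact sets -/

namespace L0

variable {Ω : Type*} [MeasurableSpace Ω] {P : Measure Ω} [IsProbabilityMeasure P]

/-- The expectation of `min (c |γ|) 1`. As `c` tends to `0`, it measures how far `γ` is from
being bounded in probability. -/
def truncInt (c : ℝ) (γ : L0 P ℝ) : ℝ := ∫ ω, min (c * |γ ω|) 1 ∂P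

theorem abs_min_mul_abs_le {c : ℝ} (hc : 0 ≤ c) (s : ℝ) : |min (c * |s|) 1| ≤ 1 := by
  rw [abs_of_nonneg (le_min (by positivity) zero_le_one)]
  exact min_le_right _ _

theorem integrable_min {c : ℝ} (hc : 0 ≤ c) (γ : L0 P ℝ) :
    Integrable (fun ω => min (c * |γ ω|) 1) P := by
  have hγ := γ.measurable
  refine integrable_of_ae_abs_le (C := 1) ?_
    (Eventually.of_forall fun ω => abs_min_mul_abs_le hc _)
  apply Measurable.aestronglyMeasurable
  fun_prop

theorem tendsto_truncInt {c : ℕ → ℝ} (hc : ∀ n, 0 ≤ c n) {γ : ℕ → L0 P ℝ} {c' : ℝ} {γ' : L0 P ℝ}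
    (h : ∀ᵐ ω ∂P, Tendsto (fun n => c n * |γ n ω|) atTop (𝓝 (c' * |γ' ω|))) :
    Tendsto (fun n => truncInt (c n) (γ n)) atTop (𝓝 (truncInt c' γ')) := by
  refine tendsto_integral_of_dominated_convergence (fun _ => 1)
    (fun n => (integrable_min (hc n) (γ n)).aestronglyMeasurable) (integrable_const 1)
    (fun n => Eventually.of_forall fun ω => abs_min_mul_abs_le (hc n) _) ?_
  filter_upwards [h] with ω h
  exact h.min tendsto_const_nhds

/-- An element of `L⁰` is bounded in probability. -/
theorem exists_truncInt_le (m : L0 P ℝ) {lam : ℝ} (hlam : 0 < lam) :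
    ∃ n : ℕ, truncInt (1 / ((n : ℝ) + 1)) m ≤ lam := by
  have hlim : Tendsto (fun n : ℕ => truncInt (1 / ((n : ℝ) + 1)) m) atTop
      (𝓝 (truncInt 0 m)) := by
    refine tendsto_truncInt (fun n => Nat.one_div_pos_of_nat.le)
      (Eventually.of_forall fun ω => ?_)
    exact tendsto_one_div_add_atTop_nhds_zero_nat.mul_const _
  have h0 : truncInt 0 m = 0 := by simp [truncInt]
  rw [h0] at hlim
  exact (hlim.eventually_le_const hlam).exists

end L0

namespace L0Seminorm

variable {Ω : Type*} [MeasurableSpace Ω] {P : Measure Ω} [IsProbabilityMeasure P]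
  {E : Type*} [AddCommGroup E] [Module (L0 P ℝ) E] (N : L0Seminorm P E)

/-- An `L⁰`-seminorm that is bounded in probability on an `L⁰`-convex set `G` is bounded on `G`
by an element of `L⁰`. -/
theorem exists_forall_le_of_truncInt {G : Set E} (hG : RealL0Convex P G) (hne : G.Nonempty)
    (hb : ∀ lam : ℝ, 0 < lam → ∃ c : ℝ, 0 < c ∧ ∀ x ∈ G, L0.truncInt c (N x) ≤ lam) :
    ∃ S : L0 P ℝ, (∀ᵐ ω ∂P, 0 ≤ S ω) ∧ ∀ x ∈ G, ∀ᵐ ω ∂P, N x ω ≤ S ω := by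
  -- by concatenation, the values of `N` on `G` are directed upwards
  have hdir : ∀ x ∈ G, ∀ y ∈ G, ∃ w ∈ G, ∀ᵐ ω ∂P, N x ω ≤ N w ω ∧ N y ω ≤ N w ω := by
    intro x hx y hy
    obtain ⟨w, hw, h1, h2⟩ := N.isLocalMap.neg.exists_le_le hG hx hy
    refine ⟨w, hw, ?_⟩
    filter_upwards [L0.le_iff.1 h1, L0.le_iff.1 h2, L0.ae_neg (N x), L0.ae_neg (N y),
      L0.ae_neg (N w)] with ω h1 h2 h3 h4 h5
    rw [h5] at h1 h2
    rw [h3] at h1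
    rw [h4] at h2
    constructor <;> linarith
  -- values are compressed into `[0, 1]`, so that a supremum of integrals is finite
  let v : E → Ω → ℝ := fun x ω => |N x ω| / (1 + |N x ω|)
  have hv0 : ∀ x ω, 0 ≤ v x ω := fun x ω => by positivity
  have hv1 : ∀ x ω, v x ω ≤ 1 := fun x ω => by
    rw [div_le_one (by positivity)]
    linarith
  have hvm : ∀ x, Measurable (v x) := fun x => by
    have := (N x).measurable
    fun_prop
  have hvmono : ∀ {a b : ℝ}, 0 ≤ a → a ≤ b → a / (1 + a) ≤ b / (1 + b) := by
    intro a b ha hab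
    rw [div_le_div_iff₀ (by positivity) (by linarith)]
    nlinarith
  have hvi : ∀ x, Integrable (v x) P := fun x =>
    L0.integrable_of_ae_abs_le (C := 1) (hvm x).aestronglyMeasurable
      (Eventually.of_forall fun ω => by rw [abs_of_nonneg (hv0 x ω)]; exact hv1 x ω)
  let α : ℝ := sSup ((fun x => ∫ ω, v x ω ∂P) '' G)
  have hbdd : BddAbove ((fun x => ∫ ω, v x ω ∂P) '' G) := by
    refine ⟨1, ?_⟩
    rintro _ ⟨x, _, rfl⟩
    have := integral_mono (hvi x) (integrable_const (1 : ℝ)) (hv1 x)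
    simpa using this
  have hz : ∀ k : ℕ, ∃ z ∈ G, α - 1 / ((k : ℝ) + 1) < ∫ ω, v z ω ∂P := by
    intro k
    have hk : α - 1 / ((k : ℝ) + 1) < α := sub_lt_self _ Nat.one_div_pos_of_nat
    obtain ⟨_, ⟨z, hz, rfl⟩, h⟩ := exists_lt_of_lt_csSup (hne.image _) hk
    exact ⟨z, hz, h⟩
  choose z hzG hzα using hz
  let V : Ω → ℝ := fun ω => ⨆ k, v (z k) ω
  have hVbdd : ∀ ω, BddAbove (range fun k => v (z k) ω) := fun ω => by
    refine ⟨1, ?_⟩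
    rintro _ ⟨k, rfl⟩
    exact hv1 _ _
  have hVm : Measurable V := Measurable.iSup fun k => hvm (z k)
  have hV0 : ∀ ω, 0 ≤ V ω := fun ω => Real.iSup_nonneg fun k => hv0 _ _
  have hzV : ∀ k ω, v (z k) ω ≤ V ω := fun k ω => le_ciSup (hVbdd ω) k
  have hV1 : ∀ ω, V ω ≤ 1 := fun ω => ciSup_le fun k => hv1 _ _
  -- `V` is the essential supremum of the family `v x`
  have hle : ∀ x ∈ G, ∀ᵐ ω ∂P, v x ω ≤ V ω := by
    intro x hx
    have hi : Integrable (fun ω => max (v x ω - V ω) 0) P := by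
      refine L0.integrable_of_ae_abs_le (C := 1) ?_ (Eventually.of_forall fun ω => ?_)
      · apply Measurable.aestronglyMeasurable
        have := hvm x
        fun_prop
      · rw [abs_of_nonneg (le_max_right _ _)]
        exact max_le (by linarith [hv1 x ω, hV0 ω]) zero_le_one
    have hk : ∀ k : ℕ, ∫ ω, max (v x ω - V ω) 0 ∂P ≤ 1 / ((k : ℝ) + 1) := by
      intro k
      obtain ⟨w, hw, hw'⟩ := hdir x hx (z k) (hzG k)
      have h1 : ∫ ω, v w ω ∂P ≤ α := le_csSup hbdd (mem_image_of_mem _ hw)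
      have h2 : ∫ ω, max (v x ω - V ω) 0 ∂P ≤ ∫ ω, (v w ω - v (z k) ω) ∂P := by
        refine integral_mono_ae hi ((hvi w).sub (hvi (z k))) ?_
        filter_upwards [hw', N.nonneg x, N.nonneg (z k), N.nonneg w] with ω h3 h4 h5 h6
        have h7 : v x ω ≤ v w ω := by
          simp only [v]
          rw [abs_of_nonneg h4, abs_of_nonneg h6]
          exact hvmono h4 h3.1
        have h8 : v (z k) ω ≤ v w ω := by
          simp only [v]
          rw [abs_of_nonneg h5, abs_of_nonneg h6]
          exact hvmono h5 h3.2
        exact max_le (by linarith [hzV k ω]) (by linarith)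
      rw [integral_sub (hvi w) (hvi (z k))] at h2
      linarith [hzα k]
    have h0 : ∫ ω, max (v x ω - V ω) 0 ∂P = 0 := by
      refine le_antisymm (ge_of_tendsto' tendsto_one_div_add_atTop_nhds_zero_nat hk) ?_
      exact integral_nonneg fun ω => le_max_right _ _
    have h1 := (integral_eq_zero_iff_of_nonneg (fun ω => le_max_right _ _) hi).1 h0
    filter_upwards [h1] with ω h
    have := (le_max_left (v x ω - V ω) 0).trans_eq h
    simp only [Pi.zero_apply] at this
    linarith
  -- boundedness in probability forbids the value `1`
  have hlt : ∀ᵐ ω ∂P, V ω < 1 := by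
    have hfin : ∀ k : ℕ, ∃ w ∈ G, ∀ᵐ ω ∂P, ∀ j ≤ k, N (z j) ω ≤ N w ω := by
      intro k
      induction k with
      | zero =>
        refine ⟨z 0, hzG 0, Eventually.of_forall fun ω j hj => ?_⟩
        rw [Nat.le_zero.1 hj]
      | succ k ih =>
        obtain ⟨w, hw, h⟩ := ih
        obtain ⟨w', hw', h'⟩ := hdir w hw (z (k + 1)) (hzG _)
        refine ⟨w', hw', ?_⟩
        filter_upwards [h, h'] with ω h1 h2 j hj
        rcases Nat.le_succ_iff.1 hj with hj | rfl
        · exact (h1 j hj).trans h2.1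
        · exact h2.2
    have hsmall : ∀ lam : ℝ, 0 < lam → P {ω | 1 ≤ V ω} ≤ ENNReal.ofReal lam := by
      intro lam hlam
      obtain ⟨c, hc, hcG⟩ := hb lam hlam
      let B : ℕ → Set Ω := fun k => {ω | 1 / c ≤ |N (z k) ω|}
      have hsub : {ω | 1 ≤ V ω} ⊆ ⋃ k, B k := by
        intro ω (hω : 1 ≤ V ω)
        by_contra hcon
        simp only [B, mem_iUnion, mem_ofPred_eq, not_exists, not_le] at hcon
        have h1 : V ω ≤ (1 / c) / (1 + 1 / c) :=
          ciSup_le fun k => hvmono (abs_nonneg _) (hcon k).le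
        have h2 : (1 / c) / (1 + 1 / c) < 1 := by
          rw [div_lt_one (by positivity)]
          linarith
        linarith
      refine (measure_mono hsub).trans ?_
      rw [measure_iUnion_eq_iSup_accumulate]
      refine iSup_le fun k => ?_
      obtain ⟨w, hw, hwk⟩ := hfin k
      have h1 : P (accumulate B k) ≤ P {ω | 1 ≤ min (c * |N w ω|) 1} := by
        refine measure_mono_ae ?_
        have hnn : ∀ᵐ ω ∂P, ∀ j, 0 ≤ N (z j) ω := ae_all_iff.2 fun j => N.nonneg _
        filter_upwards [hwk, hnn] with ω h1 h2 h3
        obtain ⟨j, hj, hjB⟩ := mem_accumulate.1 h3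
        have hjB' : 1 / c ≤ |N (z j) ω| := hjB
        rw [abs_of_nonneg (h2 j)] at hjB'
        have h4 : 1 / c ≤ |N w ω| := (hjB'.trans (h1 j hj)).trans (le_abs_self _)
        rw [div_le_iff₀ hc] at h4
        exact le_min (by linarith) le_rfl
      refine h1.trans ?_
      have h2 := mul_meas_ge_le_integral_of_nonneg (μ := P)
        (Eventually.of_forall fun ω => le_min (by positivity) zero_le_one)
        (L0.integrable_min hc.le (N w)) 1
      rw [one_mul] at h2
      have h3 := h2.trans (hcG w hw)
      rw [measureReal_def] at h3
      exact (ENNReal.le_ofReal_iff_toReal_le (measure_ne_top _ _) hlam.le).2 h3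
    have h0 : P {ω | 1 ≤ V ω} = 0 := by
      refine le_antisymm (ENNReal.le_of_forall_pos_le_add fun ε hε _ => ?_) zero_le
      rw [zero_add]
      have := hsmall ε (by exact_mod_cast hε)
      rwa [ENNReal.ofReal_coe_nnreal] at this
    have : ∀ᵐ ω ∂P, ¬ 1 ≤ V ω := by
      rw [ae_iff]
      simpa using h0
    filter_upwards [this] with ω h
    exact not_le.1 h
  have hSm : AEStronglyMeasurable (fun ω => V ω / (1 - V ω)) P := by
    apply Measurable.aestronglyMeasurable
    fun_prop
  have hS : ∀ᵐ ω ∂P, (AEEqFun.mk _ hSm : L0 P ℝ) ω = V ω / (1 - V ω) := AEEqFun.coeFn_mk _ _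
  refine ⟨AEEqFun.mk _ hSm, ?_, fun x hx => ?_⟩
  · filter_upwards [hS] with ω h1
    rw [h1]
    exact div_nonneg (hV0 ω) (by linarith [hV1 ω])
  · filter_upwards [hle x hx, hlt, N.nonneg x, hS] with ω h1 h2 h3 h4
    simp only [v] at h1
    rw [abs_of_nonneg h3, div_le_iff₀ (by positivity)] at h1
    rw [h4, le_div_iff₀ (by linarith)]
    linarith

end L0Seminorm

namespace L0Seminorm

variable {Ω : Type*} [MeasurableSpace Ω] {P : Measure Ω} [IsProbabilityMeasure P]
  {E : Type*} [AddCommGroup E] [Module (L0 P ℝ) E]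
  [Module ℝ E] [IsScalarTower ℝ (L0 P ℝ) E] (N : L0Seminorm P E)

theorem isClosed_truncInt_density_le {c : ℝ} (hc : 0 ≤ c) (x : E) (lam : ℝ) :
    IsClosed {f : StrongDual ℝ N.L1Space | L0.truncInt c (N.density f x) ≤ lam} := by
  refine IsSeqClosed.isClosed fun f f₀ hf hlim => ?_
  refine le_of_tendsto' (L0.tendsto_truncInt (fun _ => hc) ?_) hf
  have h1 : ∀ᵐ ω ∂P, ∀ n, |N.density (f n) x ω - N.density f₀ x ω| ≤ ‖f n - f₀‖ * N x ω := by
    refine ae_all_iff.2 fun n => ?_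
    filter_upwards [N.abs_density_le (f n - f₀) x, L0.ae_sub (N.density (f n) x)
      (N.density f₀ x)] with ω h1 h2
    rwa [density_sub, h2] at h1
  filter_upwards [h1] with ω h1
  refine Tendsto.const_mul c (Tendsto.abs ?_)
  rw [tendsto_iff_norm_sub_tendsto_zero]
  refine squeeze_zero (fun _ => norm_nonneg _) h1 ?_
  simpa using (tendsto_iff_norm_sub_tendsto_zero.1 hlim).mul_const (N x ω)

/-- Uniform boundedness: if every random functional given by the dual of `N.L1Space` is
bounded on `G` by an element of `L⁰`, then `N` is bounded in probability on `G`. -/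
theorem exists_truncInt_le {G : Set E}
    (hG : ∀ f : StrongDual ℝ N.L1Space, ∃ m : L0 P ℝ, ∀ y ∈ G, ∀ᵐ ω ∂P, |N.density f y ω| ≤ m ω)
    {lam : ℝ} (hlam : 0 < lam) :
    ∃ c : ℝ, 0 < c ∧ ∀ x ∈ G, L0.truncInt c (N x) ≤ lam := by
  let c : ℕ → ℝ := fun n => 1 / ((n : ℝ) + 1)
  have hc : ∀ n, 0 < c n := fun n => Nat.one_div_pos_of_nat
  let A : ℕ → Set (StrongDual ℝ N.L1Space) := fun n =>
    ⋂ x ∈ G, {f | L0.truncInt (c n) (N.density f x) ≤ lam / 2}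
  have hA : ∀ n, IsClosed (A n) := fun n =>
    isClosed_biInter fun x _ => N.isClosed_truncInt_density_le (hc n).le x _
  have hU : ⋃ n, A n = univ := by
    refine eq_univ_of_forall fun f => ?_
    obtain ⟨m, hm⟩ := hG f
    obtain ⟨n, hn⟩ := L0.exists_truncInt_le m (half_pos hlam)
    refine mem_iUnion.2 ⟨n, mem_iInter₂.2 fun x hx => le_trans ?_ hn⟩
    refine integral_mono_ae (L0.integrable_min (hc n).le _) (L0.integrable_min (hc n).le _) ?_
    filter_upwards [hm x hx] with ω h
    have := hc n
    have h' := h.trans (le_abs_self _)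
    gcongr
  -- Baire: one of the closed sets `A n` contains a ball, and a norming functional of `x` moves the
  -- centre within it
  obtain ⟨n, f₀, hf₀⟩ := nonempty_interior_of_iUnion_of_closed hA hU
  obtain ⟨r, hr, hball⟩ := Metric.isOpen_iff.1 isOpen_interior f₀ hf₀
  refine ⟨c n * (r / 2), by have := hc n; positivity, fun x hx => ?_⟩
  obtain ⟨g, hg1, hg2⟩ := N.exists_density_eq x
  have hmem : f₀ + (r / 2) • g ∈ A n := by
    refine interior_subset (hball ?_)
    rw [Metric.mem_ball, dist_eq_norm, add_sub_cancel_left, norm_smul, Real.norm_eq_abs,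
      abs_of_pos (half_pos hr)]
    have := mul_le_mul_of_nonneg_left hg1 (half_pos hr).le
    linarith
  have h1 := mem_iInter₂.1 (interior_subset hf₀) x hx
  have h2 := mem_iInter₂.1 hmem x hx
  simp only [mem_ofPred_eq, density_add, density_smul, hg2] at h1 h2
  have h3 : L0.truncInt (c n * (r / 2)) (N x) ≤
      L0.truncInt (c n) (N.density f₀ x + (r / 2) • N x) + L0.truncInt (c n) (N.density f₀ x) := by
    rw [L0.truncInt, L0.truncInt, L0.truncInt, ← integral_add (L0.integrable_min (hc n).le _)
      (L0.integrable_min (hc n).le _)]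
    refine integral_mono_ae (L0.integrable_min (by have := hc n; positivity) _)
      ((L0.integrable_min (hc n).le _).add (L0.integrable_min (hc n).le _)) ?_
    filter_upwards [L0.ae_add (N.density f₀ x) ((r / 2) • N x), L0.ae_smul (r / 2) (N x)]
      with ω h4 h5
    rw [h4, h5]
    have hpos := hc n
    generalize N.density f₀ x ω = s
    generalize N x ω = u
    have h6 : c n * (r / 2) * |u| ≤ c n * |s + r / 2 * u| + c n * |s| := by
      have : |r / 2 * u| ≤ |s + r / 2 * u| + |s| := by
        have := abs_sub (s + r / 2 * u) s
        rwa [add_sub_cancel_left] at this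
      rw [abs_mul, abs_of_pos (half_pos hr)] at this
      rw [mul_assoc, ← mul_add]
      gcongr
    have h7 : 0 ≤ c n * |s + r / 2 * u| := by positivity
    have h8 : 0 ≤ c n * |s| := by positivity
    generalize c n * |s + r / 2 * u| = p at *
    generalize c n * |s| = q at *
    change min _ 1 ≤ min p 1 + min q 1
    rcases le_total p 1 with hp | hp <;> rcases le_total q 1 with hq | hq
    · rw [min_eq_left hp, min_eq_left hq]
      exact (min_le_left _ _).trans h6
    · rw [min_eq_left hp, min_eq_right hq]
      exact (min_le_right _ _).trans (by linarith)
    · rw [min_eq_right hp, min_eq_left hq]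
      exact (min_le_right _ _).trans (by linarith)
    · rw [min_eq_right hp, min_eq_right hq]
      exact (min_le_right _ _).trans (by linarith)
  linarith

end L0Seminorm

/-! ### Weak limits and the theorem over the real algebra -/

section WeakLimit

/-- Bounded families in a real Hilbert space have weak limits along ultrafilters. -/
theorem Ultrafilter.exists_weak_limit {α H : Type*} [NormedAddCommGroup H] [InnerProductSpace ℝ H]
    [CompleteSpace H] (𝒰 : Ultrafilter α) (v : α → H) {C : ℝ} (hv : ∀ᶠ a in (𝒰 : Filter α), ‖v a‖ ≤ C) :
    ∃ w : H, ∀ h : H, Tendsto (fun a => inner ℝ (v a) h) 𝒰 (𝓝 (inner ℝ w h)) := by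
  let φ : α → WeakDual ℝ H := fun a => StrongDual.toWeakDual (InnerProductSpace.toDual ℝ H (v a))
  have hK := WeakDual.isCompact_closedBall (𝕜 := ℝ) (0 : StrongDual ℝ H) C
  obtain ⟨ℓ, _, hℓ⟩ := hK.ultrafilter_le_nhds (𝒰.map φ) (by
    rw [le_principal_iff]
    change ∀ᶠ a in (𝒰 : Filter α), φ a ∈ _
    filter_upwards [hv] with a ha
    change InnerProductSpace.toDual ℝ H (v a) ∈ Metric.closedBall 0 C
    rwa [mem_closedBall_zero_iff, LinearIsometryEquiv.norm_map])
  refine ⟨(InnerProductSpace.toDual ℝ H).symm (WeakDual.toStrongDual ℓ), fun h => ?_⟩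
  rw [InnerProductSpace.toDual_symm_apply]
  have h1 : Tendsto φ 𝒰 (𝓝 ℓ) := hℓ
  exact ((WeakDual.eval_continuous h).tendsto ℓ).comp h1

variable {Ω : Type*} [MeasurableSpace Ω] {P : Measure Ω} [IsProbabilityMeasure P]

/-- Families in `L⁰` bounded by `1` have weak `L²` limits along ultrafilters. -/
theorem Ultrafilter.exists_weak_limit_L0 {α : Type*} (𝒰 : Ultrafilter α) (v : α → L0 P ℝ) {G : Set α}
    (hG : G ∈ 𝒰) (hv : ∀ a ∈ G, ∀ᵐ ω ∂P, |v a ω| ≤ 1) :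
    ∃ γ : L0 P ℝ, MemLp γ 2 P ∧ ∀ h : Ω → ℝ, MemLp h 2 P →
      Tendsto (fun a => ∫ ω, v a ω * h ω ∂P) 𝒰 (𝓝 (∫ ω, γ ω * h ω ∂P)) := by
  classical
  have hm : ∀ a ∈ G, MemLp (v a) 2 P := fun a ha =>
    MemLp.of_bound (AEEqFun.aestronglyMeasurable _) 1 (hv a ha)
  let V : α → Lp ℝ 2 P := fun a => if h : MemLp (v a) 2 P then h.toLp else 0
  have hV : ∀ a ∈ G, V a =ᵐ[P] v a := fun a ha => by
    simp only [V, dif_pos (hm a ha)]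
    exact (hm a ha).coeFn_toLp
  obtain ⟨w, hw⟩ := 𝒰.exists_weak_limit V (C := measureUnivNNReal P ^ (2 : ENNReal).toReal⁻¹ * 1) (by
    filter_upwards [hG] with a ha
    refine Lp.norm_le_of_ae_bound (f := V a) zero_le_one ?_
    filter_upwards [hV a ha, hv a ha] with ω h1 h2
    rw [h1]
    exact h2)
  refine ⟨(w : L0 P ℝ), Lp.memLp w, fun h hh => ?_⟩
  have hinner : ∀ (a : Lp ℝ 2 P), inner ℝ a hh.toLp = ∫ ω, a ω * h ω ∂P := by
    intro a
    rw [L2.inner_def]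
    refine integral_congr_ae ?_
    filter_upwards [hh.coeFn_toLp] with ω h1
    rw [h1]
    simp [mul_comm]
  have h1 := hw hh.toLp
  rw [hinner] at h1
  refine h1.congr' ?_
  filter_upwards [hG] with a ha
  rw [hinner]
  refine integral_congr_ae ?_
  filter_upwards [hV a ha] with ω h1
  rw [h1]

end WeakLimit

section Separation

variable {Ω : Type*} [MeasurableSpace Ω] {P : Measure Ω} {E : Type*} [AddCommGroup E]
  [Module (L0 P ℝ) E] [Module ℝ E] [IsScalarTower ℝ (L0 P ℝ) E]

/-- Hahn–Banach separation, in the seminormed space `M.L1Space`, of a point from a convex set at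
positive distance. -/
theorem L0Seminorm.exists_separating (M : L0Seminorm P E) {F : Set E} (hF : Convex ℝ F)
    (hFM : ∀ y ∈ F, y ∈ M.L1Space) {x : E} (hx : x ∈ M.L1Space) {r : ℝ} (hr : 0 < r)
    (hdist : ∀ y ∈ F, r ≤ ∫ ω, M (y - x) ω ∂P) :
    ∃ (f : StrongDual ℝ M.L1Space) (u : ℝ), f ⟨x, hx⟩ < u ∧
      ∀ (y : E) (hy : y ∈ F), u ≤ f ⟨y, hFM y hy⟩ := by
  let x' : M.L1Space := ⟨x, hx⟩
  let F' : Set M.L1Space := M.L1Space.subtype ⁻¹' F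
  have hdisj : Disjoint (Metric.ball x' r) F' := by
    rw [Set.disjoint_left]
    intro y hy hyF
    rw [Metric.mem_ball, dist_eq_norm] at hy
    exact absurd (hdist y hyF) (not_le.2 hy)
  obtain ⟨f, u, hfu, huf⟩ := geometric_hahn_banach_open (convex_ball x' r) Metric.isOpen_ball
    (hF.linear_preimage M.L1Space.subtype) hdisj
  exact ⟨f, u, hfu x' (Metric.mem_ball_self hr), fun y hy => huf ⟨y, _⟩ hy⟩

end Separation

section Core

variable {Ω : Type*} [MeasurableSpace Ω] {P : Measure Ω}
  {E : Type*} [AddCommGroup E] [Module (L0 P ℝ) E] {κ : Type*}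
  {t : TopologicalSpace E} {N : κ → L0Seminorm P E}

/-- The variational inequality at a minimum of `sumSq` over an `L⁰`-convex set. -/
theorem ae_sum_mul_nonneg_of_forall_sumSq_le {J : Type*} {s : Finset J}
    {g : J → E →ₗ[L0 P ℝ] L0 P ℝ} {γ : J → L0 P ℝ} {G : Set E} (hG : RealL0Convex P G) {x y : E}
    (hx : x ∈ G) (hy : y ∈ G) (hmin : ∀ y ∈ G, sumSq s g γ x ≤ sumSq s g γ y) :
    ∀ᵐ ω ∂P, 0 ≤ ∑ j ∈ s, (g j y ω - g j x ω) * (g j x ω - γ j ω) := by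
  -- compare `x` with `τ y + (1 - τ) x`, divide by `τ` and let `τ` tend to `0`
  have hτ : ∀ τ : ℝ, 0 < τ → τ ≤ 1 → ∀ᵐ ω ∂P,
      0 ≤ 2 * (∑ j ∈ s, (g j y ω - g j x ω) * (g j x ω - γ j ω)) +
        τ * ∑ j ∈ s, (g j y ω - g j x ω) ^ 2 := by
    intro τ h0 h1
    have hc : ∀ᵐ ω ∂P, (τ • (1 : L0 P ℝ)) ω = τ := by
      filter_upwards [L0.ae_smul τ (1 : L0 P ℝ), L0.ae_one (P := P)] with ω h1 h2
      rw [h1, h2, mul_one]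
    have hmem := hG y hy x hx (τ • (1 : L0 P ℝ))
      (L0.le_iff.2 (by
        filter_upwards [hc, L0.ae_zero (P := P)] with ω h2 h3
        rw [h2, h3]
        exact h0.le))
      (L0.le_iff.2 (by
        filter_upwards [hc, L0.ae_one (P := P)] with ω h2 h3
        rw [h2, h3]
        exact h1))
    have h : ∀ᵐ ω ∂P, ∀ j ∈ s, _ :=
      (Finset.eventually_all s).2 fun j _ => (g j).ae_smul_add_smul (τ • (1 : L0 P ℝ)) y x
    filter_upwards [hc, h, L0.le_iff.1 (hmin _ hmem), ae_sumSq s g γ x,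
      ae_sumSq s g γ ((τ • (1 : L0 P ℝ)) • y + (1 - τ • (1 : L0 P ℝ)) • x)] with ω h2 h3 h4 h5 h6
    rw [h5, h6] at h4
    have h7 : ∑ j ∈ s, (g j ((τ • (1 : L0 P ℝ)) • y + (1 - τ • (1 : L0 P ℝ)) • x) ω - γ j ω) ^ 2 =
        ∑ j ∈ s, (g j x ω - γ j ω) ^ 2 +
          τ * (2 * (∑ j ∈ s, (g j y ω - g j x ω) * (g j x ω - γ j ω)) +
            τ * ∑ j ∈ s, (g j y ω - g j x ω) ^ 2) := by
      rw [Finset.mul_sum, Finset.mul_sum, ← Finset.sum_add_distrib, Finset.mul_sum,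
        ← Finset.sum_add_distrib]
      refine Finset.sum_congr rfl fun j hj => ?_
      rw [h3 j hj, h2]
      ring
    rw [h7] at h4
    by_contra hcon
    have := mul_neg_of_pos_of_neg h0 (not_le.1 hcon)
    linarith
  have hall : ∀ᵐ ω ∂P, ∀ n : ℕ,
      0 ≤ 2 * (∑ j ∈ s, (g j y ω - g j x ω) * (g j x ω - γ j ω)) +
        1 / ((n : ℝ) + 1) * ∑ j ∈ s, (g j y ω - g j x ω) ^ 2 := by
    refine ae_all_iff.2 fun n => hτ _ Nat.one_div_pos_of_nat ?_
    rw [div_le_one (by positivity)]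
    linarith [(Nat.cast_nonneg n : (0 : ℝ) ≤ n)]
  filter_upwards [hall] with ω h
  have hlim := ((tendsto_one_div_add_atTop_nhds_zero_nat (𝕜 := ℝ)).mul_const
    (∑ j ∈ s, (g j y ω - g j x ω) ^ 2)).const_add
      (2 * (∑ j ∈ s, (g j y ω - g j x ω) * (g j x ω - γ j ω)))
  have := ge_of_tendsto' hlim h
  linarith

/-- The multiple `|ρ| N` of an `L⁰`-seminorm. -/
def L0Seminorm.scale (M : L0Seminorm P E) (ρ : L0 P ℝ) : L0Seminorm P E where
  toFun x := |ρ| * M x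
  nonneg' x := by
    filter_upwards [L0.ae_mul |ρ| (M x), AEEqFun.coeFn_abs ρ, M.nonneg x] with ω h1 h2 h3
    rw [h1, h2]
    positivity
  add_le' x y := by
    filter_upwards [L0.ae_mul |ρ| (M (x + y)), L0.ae_mul |ρ| (M x), L0.ae_mul |ρ| (M y),
      AEEqFun.coeFn_abs ρ, M.add_le x y] with ω h1 h2 h3 h4 h5
    rw [h1, h2, h3, h4, ← mul_add]
    gcongr
  smul' ξ x := by
    filter_upwards [L0.ae_mul |ρ| (M (ξ • x)), L0.ae_mul |ρ| (M x), M.smul ξ x] with ω h1 h2 h3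
    rw [h1, h2, h3]
    ring

theorem L0Seminorm.coeFn_scale (M : L0Seminorm P E) (ρ : L0 P ℝ) (x : E) :
    ∀ᵐ ω ∂P, M.scale ρ x ω = |ρ ω| * M x ω := by
  filter_upwards [L0.ae_mul |ρ| (M x), AEEqFun.coeFn_abs ρ] with ω h1 h2
  change (|ρ| * M x) ω = _
  rw [h1, h2]

variable [IsProbabilityMeasure P]

/-- On an `L⁰`-convexly compact set, the weak limits of finitely many bounded random functionals
along an ultrafilter are attained simultaneously at one point: the minimizer of the sum of the
squared distances. -/
theorem IsEpsilonLambda.exists_forall_eq_weak_limit (ht : IsEpsilonLambda t N) {G : Set E}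
    (hG : RealL0Convex P G) (hc : IsFIPCompact t (RealL0Convex P) G) (𝒰 : Ultrafilter E)
    (hGU : G ∈ 𝒰) {J : Type*} (s : Finset J) (g : J → E →ₗ[L0 P ℝ] L0 P ℝ)
    (hg : ∀ j ∈ s, IsDominated N (g j)) (hg1 : ∀ j ∈ s, ∀ y ∈ G, ∀ᵐ ω ∂P, |g j y ω| ≤ 1)
    (γ : J → L0 P ℝ) (hγ : ∀ j ∈ s, MemLp (γ j) 2 P)
    (hlim : ∀ j ∈ s, ∀ h : Ω → ℝ, MemLp h 2 P →
      Tendsto (fun y => ∫ ω, g j y ω * h ω ∂P) 𝒰 (𝓝 (∫ ω, γ j ω * h ω ∂P))) :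
    ∃ x ∈ G, ∀ j ∈ s, g j x = γ j := by
  obtain ⟨x, hx, hmin⟩ := (isLocalMap_sumSq s g γ).exists_forall_le hG hc
    (Ultrafilter.nonempty_of_mem hGU) (realL0Convex_sumSq_le s g γ) (ht.isClosed_sumSq_le s g hg γ)
  refine ⟨x, hx, ?_⟩
  have hgL : ∀ j ∈ s, ∀ y ∈ G, MemLp (g j y) 2 P := fun j hj y hy =>
    MemLp.of_bound (AEEqFun.aestronglyMeasurable _) 1 (hg1 j hj y hy)
  let h : J → Ω → ℝ := fun j ω => g j x ω - γ j ω
  have hh : ∀ j ∈ s, MemLp (h j) 2 P := fun j hj => (hgL j hj x hx).sub (hγ j hj)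
  have hi : ∀ j ∈ s, ∀ y ∈ G, Integrable (fun ω => g j y ω * h j ω) P := fun j hj y hy =>
    (hgL j hj y hy).integrable_mul (hh j hj)
  have hi' : ∀ j ∈ s, Integrable (fun ω => γ j ω * h j ω) P := fun j hj =>
    (hγ j hj).integrable_mul (hh j hj)
  have h1 : ∀ y ∈ G, ∑ j ∈ s, ∫ ω, g j x ω * h j ω ∂P ≤ ∑ j ∈ s, ∫ ω, g j y ω * h j ω ∂P := by
    intro y hy
    rw [← integral_finsetSum s fun j hj => hi j hj x hx,
      ← integral_finsetSum s fun j hj => hi j hj y hy]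
    refine integral_mono_ae (integrable_finsetSum s fun j hj => hi j hj x hx)
      (integrable_finsetSum s fun j hj => hi j hj y hy) ?_
    filter_upwards [ae_sum_mul_nonneg_of_forall_sumSq_le hG hx hy hmin] with ω h2
    rw [← sub_nonneg, ← Finset.sum_sub_distrib]
    refine h2.trans_eq (Finset.sum_congr rfl fun j _ => ?_)
    simp only [h]
    ring
  have h2 : ∑ j ∈ s, ∫ ω, g j x ω * h j ω ∂P ≤ ∑ j ∈ s, ∫ ω, γ j ω * h j ω ∂P := by
    refine ge_of_tendsto (tendsto_finsetSum s fun j hj => hlim j hj (h j) (hh j hj)) ?_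
    filter_upwards [hGU] with y hy
    exact h1 y hy
  -- the difference of the two sides of `h2` is the sum of the squared `L²` distances
  have h3 : ∑ j ∈ s, ∫ ω, h j ω ^ 2 ∂P ≤ 0 := by
    have : ∑ j ∈ s, ∫ ω, h j ω ^ 2 ∂P =
        ∑ j ∈ s, ∫ ω, g j x ω * h j ω ∂P - ∑ j ∈ s, ∫ ω, γ j ω * h j ω ∂P := by
      rw [← Finset.sum_sub_distrib]
      refine Finset.sum_congr rfl fun j hj => ?_
      rw [← integral_sub (hi j hj x hx) (hi' j hj)]
      refine integral_congr_ae (Eventually.of_forall fun ω => ?_)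
      simp only [h]
      ring
    linarith
  intro j hj
  have hnn : ∀ i ∈ s, 0 ≤ ∫ ω, h i ω ^ 2 ∂P := fun i _ => integral_nonneg fun ω => sq_nonneg _
  have h4 : ∫ ω, h j ω ^ 2 ∂P = 0 :=
    (Finset.sum_eq_zero_iff_of_nonneg hnn).1 (le_antisymm h3 (Finset.sum_nonneg hnn)) j hj
  have h5 := (integral_eq_zero_iff_of_nonneg (fun ω => sq_nonneg _) (hh j hj).integrable_sq).1 h4
  apply AEEqFun.ext
  filter_upwards [h5] with ω h6
  have : h j ω = 0 := pow_eq_zero_iff two_ne_zero |>.1 h6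
  simp only [h] at this
  linarith

/-- A weighted seminorm `N / (1 + S)` is bounded below in mean, uniformly over all `z` for which
`N z` is bounded below in probability. -/
theorem L0Seminorm.exists_le_integral_scale_rcp (M : L0Seminorm P E) (S : L0 P ℝ) {ε δ : ℝ}
    (hε : 0 < ε) (hδ : 0 < δ) : ∃ r : ℝ, 0 < r ∧ ∀ z : E, δ ≤ P.real {ω | ε ≤ M z ω} →
      Integrable (M.scale (L0.rcp S) z) P → r ≤ ∫ ω, M.scale (L0.rcp S) z ω ∂P := by
  obtain ⟨n, hcS⟩ := L0.exists_truncInt_le S (half_pos hδ)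
  have hc : 0 < 1 / ((n : ℝ) + 1) := Nat.one_div_pos_of_nat
  generalize 1 / ((n : ℝ) + 1) = c at hc hcS
  refine ⟨ε / (1 + 1 / c) * (δ / 2), by positivity, fun z hz hint => ?_⟩
  have hA : MeasurableSet {ω | ε ≤ M z ω} :=
    measurableSet_le measurable_const (AEEqFun.measurable _)
  have hi1 : Integrable ({ω | ε ≤ M z ω}.indicator (1 : Ω → ℝ)) P :=
    (integrable_const (1 : ℝ)).indicator hA
  have hi2 := L0.integrable_min hc.le S
  have h1 : ∫ ω, ε / (1 + 1 / c) * ({ω | ε ≤ M z ω}.indicator (1 : Ω → ℝ) ω - min (c * |S ω|) 1) ∂P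
      ≤ ∫ ω, M.scale (L0.rcp S) z ω ∂P := by
    refine integral_mono_ae ((hi1.sub hi2).const_mul _) hint ?_
    filter_upwards [M.coeFn_scale (L0.rcp S) z, L0.coeFn_rcp S, M.nonneg z] with ω h1 h2 h3
    rw [h1, h2, abs_of_nonneg (a := (1 + |S ω|)⁻¹) (by positivity)]
    have hpos : 0 ≤ (1 + |S ω|)⁻¹ * M z ω := by positivity
    have hK : 0 < ε / (1 + 1 / c) := by positivity
    by_cases hω : ε ≤ M z ω
    · rw [indicator_of_mem (show ω ∈ {ω | ε ≤ M z ω} from hω), Pi.one_apply]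
      rcases le_total 1 (c * |S ω|) with h4 | h4
      · rw [min_eq_right h4, sub_self, mul_zero]
        exact hpos
      · have h5 : |S ω| ≤ 1 / c := by
          rw [le_div_iff₀ hc]
          linarith
        have h6 : 0 ≤ min (c * |S ω|) 1 := le_min (by positivity) zero_le_one
        calc ε / (1 + 1 / c) * (1 - min (c * |S ω|) 1) ≤ ε / (1 + 1 / c) * 1 := by
              gcongr
              linarith
          _ = (1 + 1 / c)⁻¹ * ε := by rw [mul_one, div_eq_inv_mul]
          _ ≤ (1 + |S ω|)⁻¹ * M z ω := by gcongr
    · rw [indicator_of_notMem (show ω ∉ {ω | ε ≤ M z ω} from hω)]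
      have h6 : 0 ≤ min (c * |S ω|) 1 := le_min (by positivity) zero_le_one
      refine le_trans ?_ hpos
      exact mul_nonpos_of_nonneg_of_nonpos hK.le (by linarith)
  refine le_trans ?_ h1
  rw [integral_const_mul, integral_sub hi1 hi2, integral_indicator_one hA]
  have h2 : ∫ ω, min (c * |S ω|) 1 ∂P ≤ δ / 2 := hcS
  gcongr
  linarith

variable [Module ℝ E] [IsScalarTower ℝ (L0 P ℝ) E]

/-- Each of the seminorms is bounded on an `L⁰`-convexly compact set by an element of `L⁰`. -/
theorem IsEpsilonLambda.exists_forall_seminorm_le (ht : IsEpsilonLambda t N) {G : Set E}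
    (hG : RealL0Convex P G) (hc : IsFIPCompact t (RealL0Convex P) G) (hne : G.Nonempty) (a : κ) :
    ∃ S : L0 P ℝ, (∀ᵐ ω ∂P, 0 ≤ S ω) ∧ ∀ x ∈ G, ∀ᵐ ω ∂P, N a x ω ≤ S ω := by
  refine (N a).exists_forall_le_of_truncInt hG hne fun lam hlam =>
    (N a).exists_truncInt_le (fun f => ?_) hlam
  refine ht.exists_forall_abs_le hG hc (g := (N a).density f)
    ⟨a, ‖f‖ • (1 : L0 P ℝ), fun x => by
      filter_upwards [(N a).abs_density_le f x, L0.ae_smul ‖f‖ (1 : L0 P ℝ), L0.ae_one (P := P)]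
        with ω h1 h2 h3
      rwa [h2, h3, mul_one, abs_of_nonneg (norm_nonneg f)]⟩

/-- `L⁰`-convexly compact sets are convexly compact: the form of the theorem for modules over the
real algebra `L⁰(𝓕, ℝ)`. -/
theorem IsEpsilonLambda.isFIPCompact_convex (ht : IsEpsilonLambda t N) {G : Set E}
    (hG : RealL0Convex P G) (hc : IsFIPCompact t (RealL0Convex P) G) :
    IsFIPCompact t (Convex ℝ) G := by
  classical
  intro 𝓕 ⟨F₀, hF₀⟩ h𝓕 hfip
  have hsub : ∀ F ∈ 𝓕, F ⊆ G := fun F hF => by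
    obtain ⟨_, Z, _, rfl⟩ := h𝓕 F hF
    exact inter_subset_left
  have hneBot : (Filter.generate 𝓕).NeBot := by
    rw [Filter.generate_neBot_iff]
    intro 𝓢 h𝓢 hfin
    rcases 𝓢.eq_empty_or_nonempty with rfl | hne
    · rw [sInter_empty]
      exact univ_nonempty
    · exact hfip 𝓢 h𝓢 hfin hne
  let 𝒰 : Ultrafilter E := Ultrafilter.of (Filter.generate 𝓕)
  have hmem𝒰 : ∀ F ∈ 𝓕, F ∈ 𝒰 := fun F hF =>
    Ultrafilter.of_le (Filter.generate 𝓕) (Filter.mem_generate_of_mem hF)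
  have hG𝒰 : G ∈ 𝒰 := mem_of_superset (hmem𝒰 F₀ hF₀) (hsub F₀ hF₀)
  let J := {g : E →ₗ[L0 P ℝ] L0 P ℝ // IsDominated N g ∧ ∀ y ∈ G, ∀ᵐ ω ∂P, |g y ω| ≤ 1}
  have hwl : ∀ j : J, _ := fun j => 𝒰.exists_weak_limit_L0 (fun y => j.1 y) hG𝒰 j.2.2
  choose γ hγL hγ using hwl
  -- a point of `G` at which every bounded random functional takes its weak limit
  obtain ⟨x, hx⟩ : ∃ x, x ∈ G ∧ ∀ j : J, j.1 x = γ j := by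
    have hzero : IsDominated N (0 : E →ₗ[L0 P ℝ] L0 P ℝ) ∧
        ∀ y ∈ G, ∀ᵐ ω ∂P, |(0 : E →ₗ[L0 P ℝ] L0 P ℝ) y ω| ≤ 1 := by
      refine ⟨⟨ht.nonempty.some, 0, fun x => ?_⟩, fun y _ => ?_⟩
      · filter_upwards [L0.ae_zero (P := P)] with ω h
        rw [LinearMap.zero_apply, h]
        simp
      · filter_upwards [L0.ae_zero (P := P)] with ω h
        rw [LinearMap.zero_apply, h]
        simp
    obtain ⟨x, hx⟩ := hc (range fun j : J => G ∩ {x | j.1 x = γ j}) ⟨_, ⟨0, hzero⟩, rfl⟩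
      (by
        rintro _ ⟨j, rfl⟩
        exact ⟨hG.inter (realL0Convex_eq _ _), _, ht.isClosed_eq j.2.1 _, rfl⟩)
      (by
        intro 𝓢 h𝓢 hfin _
        have : Nonempty J := ⟨⟨0, hzero⟩⟩
        choose! ψ hψ using h𝓢
        obtain ⟨x, hx, hxs⟩ := ht.exists_forall_eq_weak_limit hG hc 𝒰 hG𝒰
          (hfin.toFinset.image ψ) (fun j => j.1)
          (fun j _ => j.2.1) (fun j _ => j.2.2) γ (fun j _ => hγL j) (fun j _ => hγ j)
        refine ⟨x, fun F hF => ?_⟩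
        rw [← hψ hF]
        exact ⟨hx, hxs _ (Finset.mem_image_of_mem ψ (hfin.mem_toFinset.2 hF))⟩)
    exact ⟨x, (hx _ ⟨⟨0, hzero⟩, rfl⟩).1, fun j => (hx _ ⟨j, rfl⟩).2⟩
  obtain ⟨hxG, hxJ⟩ := hx
  refine ⟨x, fun F hF => ?_⟩
  by_contra hxF
  obtain ⟨hFconv, Z, hZ, hFZ⟩ := h𝓕 F hF
  have hxZ : x ∉ Z := fun h => hxF (by rw [hFZ]; exact ⟨hxG, h⟩)
  obtain ⟨a, ε, δ, hε, hδ, hsep⟩ := ht.exists_le_measureReal Z hZ x hxZ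
  -- the weight `1 / (1 + S)` makes the separating seminorm bounded by `1` on `G`
  obtain ⟨S, hS0, hS⟩ := ht.exists_forall_seminorm_le hG hc ⟨x, hxG⟩ a
  let M : L0Seminorm P E := (N a).scale (L0.rcp S)
  have hM1 : ∀ y ∈ G, ∀ᵐ ω ∂P, M y ω ≤ 1 := fun y hy => by
    filter_upwards [(N a).coeFn_scale (L0.rcp S) y, L0.coeFn_rcp S, hS0, hS y hy]
      with ω h1 h2 h3 h4
    change M y ω = _ at h1
    rw [h1, h2, abs_of_nonneg (by positivity), abs_of_nonneg h3, inv_mul_le_one₀ (by positivity)]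
    linarith
  have hMmem : ∀ y ∈ G, y ∈ M.L1Space := fun y hy =>
    M.mem_L1Space_of_ae_le (integrable_const (1 : ℝ)) (hM1 y hy)
  obtain ⟨r, hr, hrz⟩ := (N a).exists_le_integral_scale_rcp S hε hδ
  obtain ⟨f, u, hfx, huf⟩ := M.exists_separating hFconv (fun y hy => hMmem y (hsub F hF hy))
    (hMmem x hxG) hr fun y hy => hrz _ (hsep y (by rw [hFZ] at hy; exact hy.2))
      (M.L1Space.sub_mem (hMmem y (hsub F hF hy)) (hMmem x hxG))
  -- normalize the random density of `f` so that it is bounded by `1` on `G`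
  let q : ℝ := (‖f‖ + 1)⁻¹
  have hq : 0 < q := by have := norm_nonneg f; positivity
  let g : E →ₗ[L0 P ℝ] L0 P ℝ := (q • (1 : L0 P ℝ)) • M.density f
  have hgae : ∀ y, ∀ᵐ ω ∂P, g y ω = q * M.density f y ω := fun y => by
    change ∀ᵐ ω ∂P, ((q • (1 : L0 P ℝ)) * M.density f y) ω = _
    filter_upwards [L0.ae_mul (q • (1 : L0 P ℝ)) (M.density f y), L0.ae_smul q (1 : L0 P ℝ),
      L0.ae_one (P := P)] with ω h1 h2 h3
    rw [h1, h2, h3, mul_one]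
  have hgdom : IsDominated N g := by
    refine IsDominated.smul ⟨a, ‖f‖ • L0.rcp S, fun y => ?_⟩ _
    filter_upwards [M.abs_density_le f y, (N a).coeFn_scale (L0.rcp S) y,
      L0.ae_smul ‖f‖ (L0.rcp S)] with ω h1 h2 h3
    change M y ω = _ at h2
    rwa [h3, abs_mul, abs_of_nonneg (norm_nonneg f), mul_assoc, ← h2]
  have hg1 : ∀ y ∈ G, ∀ᵐ ω ∂P, |g y ω| ≤ 1 := fun y hy => by
    filter_upwards [hgae y, M.abs_density_le f y, hM1 y hy] with ω h1 h2 h3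
    rw [h1, abs_mul, abs_of_pos hq]
    calc q * |M.density f y ω| ≤ q * (‖f‖ * 1) := by
          gcongr
          exact h2.trans (by gcongr)
      _ ≤ 1 := by
          simp only [q]
          rw [mul_one, inv_mul_le_one₀ (by positivity)]
          linarith
  have hgint : ∀ (y : E) (hy : y ∈ G), ∫ ω, g y ω * 1 ∂P = q * f ⟨y, hMmem y hy⟩ := by
    intro y hy
    rw [M.apply_eq_integral_density f (hM1 y hy) (hMmem y hy), ← integral_const_mul]
    refine integral_congr_ae ?_
    filter_upwards [hgae y] with ω h1
    rw [mul_one, h1]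
  have hlim := hγ ⟨g, hgdom, hg1⟩ (fun _ => 1) (memLp_const 1)
  rw [← hxJ ⟨g, hgdom, hg1⟩] at hlim
  have hle : q * u ≤ ∫ ω, g x ω * 1 ∂P := by
    refine ge_of_tendsto hlim ?_
    filter_upwards [hmem𝒰 F hF] with y hy
    change q * u ≤ ∫ ω, g y ω * 1 ∂P
    rw [hgint y (hsub F hF hy)]
    exact mul_le_mul_of_nonneg_left (huf y hy) hq.le
  rw [hgint x hxG] at hle
  exact absurd (le_of_mul_le_mul_left hle hq) (not_le.2 hfx)

end Core

/-! ### Random locally convex modules over `K` -/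

section RealStructure

variable {Ω : Type*} [MeasurableSpace Ω] {P : Measure Ω} {K : Type*} [RCLike K]

theorem L0.ae_ofReal (ξ : L0 P ℝ) : ∀ᵐ ω ∂P, L0.ofReal K ξ ω = (ξ ω : K) :=
  AEEqFun.coeFn_comp _ _ ξ

/-- The inclusion of `L⁰(𝓕, ℝ)` in `L⁰(𝓕, K)` as a ring homomorphism. -/
def L0.ofRealHom (P : Measure Ω) (K : Type*) [RCLike K] : L0 P ℝ →+* L0 P K where
  toFun := L0.ofReal K
  map_one' := by
    apply AEEqFun.ext
    filter_upwards [L0.ae_ofReal (K := K) (1 : L0 P ℝ), L0.ae_one (P := P),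
      (AEEqFun.coeFn_one : ⇑(1 : L0 P K) =ᵐ[P] 1)] with ω h1 h2 h3
    rw [h1, h2, h3, RCLike.ofReal_one, Pi.one_apply]
  map_mul' a b := by
    apply AEEqFun.ext
    filter_upwards [L0.ae_ofReal (K := K) (a * b), L0.ae_ofReal (K := K) a,
      L0.ae_ofReal (K := K) b, L0.ae_mul a b,
      AEEqFun.coeFn_mul (L0.ofReal K a) (L0.ofReal K b)] with ω h1 h2 h3 h4 h5
    rw [h1, h4, h5, Pi.mul_apply, h2, h3, RCLike.ofReal_mul]
  map_zero' := by
    apply AEEqFun.ext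
    filter_upwards [L0.ae_ofReal (K := K) (0 : L0 P ℝ), L0.ae_zero (P := P),
      (AEEqFun.coeFn_zero : ⇑(0 : L0 P K) =ᵐ[P] 0)] with ω h1 h2 h3
    rw [h1, h2, h3, RCLike.ofReal_zero, Pi.zero_apply]
  map_add' a b := by
    apply AEEqFun.ext
    filter_upwards [L0.ae_ofReal (K := K) (a + b), L0.ae_ofReal (K := K) a,
      L0.ae_ofReal (K := K) b, L0.ae_add a b,
      AEEqFun.coeFn_add (L0.ofReal K a) (L0.ofReal K b)] with ω h1 h2 h3 h4 h5
    rw [h1, h4, h5, Pi.add_apply, h2, h3, RCLike.ofReal_add]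

variable (P K) (E : Type*) [AddCommGroup E] [Module (L0 P K) E]

/-- The structure of module over the real algebra `L⁰(𝓕, ℝ)` underlying an
`L⁰(𝓕, K)`-module. -/
@[reducible]
def L0.restrictScalars : Module (L0 P ℝ) E :=
  Module.compHom E (L0.ofRealHom P K)

theorem L0.isScalarTower_restrictScalars :
    letI := L0.realModule P K E
    letI := L0.restrictScalars P K E
    IsScalarTower ℝ (L0 P ℝ) E := by
  let := L0.realModule P K E
  let := L0.restrictScalars P K E
  refine ⟨fun r ξ x => ?_⟩
  change L0.ofReal K (r • ξ) • x = L0.constHom P K r • (L0.ofReal K ξ • x)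
  rw [smul_smul]
  congr 1
  have hr : ∀ᵐ ω ∂P, L0.constHom P K r ω = (r : K) := AEEqFun.coeFn_const Ω (r : K)
  apply AEEqFun.ext
  filter_upwards [L0.ae_ofReal (K := K) (r • ξ), L0.ae_ofReal (K := K) ξ, L0.ae_smul r ξ,
    AEEqFun.coeFn_mul (L0.constHom P K r) (L0.ofReal K ξ), hr]
    with ω h1 h2 h3 h4 h5
  rw [h1, h3, h4, Pi.mul_apply, h5, h2, RCLike.ofReal_mul]

variable {E}

theorem isL0Convex_iff_realL0Convex (G : Set E) :
    letI := L0.restrictScalars P K E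
    IsL0Convex P K G ↔ RealL0Convex P G := by
  let := L0.restrictScalars P K E
  have h : ∀ (ξ : L0 P ℝ) (y : E), (1 - ξ) • y = (1 - L0.ofReal K ξ) • y := fun ξ y => by
    change L0.ofRealHom P K (1 - ξ) • y = _
    rw [map_sub, map_one]
    rfl
  constructor
  · intro hG x hx y hy ξ h0 h1
    rw [h]
    exact hG x hx y hy ξ h0 h1
  · intro hG x hx y hy ξ h0 h1
    rw [← h]
    exact hG x hx y hy ξ h0 h1

end RealStructure

/-- Real scalars in `[0, 1]` act as constant elements of `L⁰`. -/
theorem RealL0Convex.convex {Ω : Type*} [MeasurableSpace Ω] {P : Measure Ω} {E : Type*}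
    [AddCommGroup E] [Module (L0 P ℝ) E] [Module ℝ E] [IsScalarTower ℝ (L0 P ℝ) E] {G : Set E}
    (hG : RealL0Convex P G) : Convex ℝ G := by
  intro x hx y hy a b ha hb hab
  have hc : ∀ᵐ ω ∂P, (a • (1 : L0 P ℝ)) ω = a := by
    filter_upwards [L0.ae_smul a (1 : L0 P ℝ), L0.ae_one (P := P)] with ω h1 h2
    rw [h1, h2, mul_one]
  have h := hG x hx y hy (a • (1 : L0 P ℝ))
    (L0.le_iff.2 (by
      filter_upwards [hc, L0.ae_zero (P := P)] with ω h1 h2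
      rwa [h1, h2]))
    (L0.le_iff.2 (by
      filter_upwards [hc, L0.ae_one (P := P)] with ω h1 h2
      rw [h1, h2]
      linarith))
  have hb' : (1 : L0 P ℝ) - a • (1 : L0 P ℝ) = b • (1 : L0 P ℝ) := by
    rw [sub_eq_iff_eq_add, ← add_smul, add_comm b a, hab, one_smul]
  rwa [hb', smul_assoc, smul_assoc, one_smul, one_smul] at h

namespace RandomLCModule

variable {Ω : Type*} [MeasurableSpace Ω] {P : Measure Ω} {K : Type*} [RCLike K]
  {ι : Type*} {E : Type*} [AddCommGroup E] [Module (L0 P K) E] (M : RandomLCModule P K ι E)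

theorem supNorm_smul (Q : Finset ι) (ξ : L0 P K) (x : E) : ∀ᵐ ω ∂P,
    (M.supNorm Q (ξ • x) : L0 P ℝ) ω = ‖ξ ω‖ * (M.supNorm Q x : L0 P ℝ) ω := by
  classical
  induction Q using Finset.induction_on with
  | empty =>
    have h : ∀ y : E, (M.supNorm ∅ y : L0 P ℝ) = 0 := fun y => rfl
    rw [h, h]
    filter_upwards [L0.ae_zero (P := P)] with ω h1
    rw [h1, mul_zero]
  | insert i Q _ ih =>
    have h : ∀ y : E, (M.supNorm (insert i Q) y : L0 P ℝ) =
        (M.norm i y : L0 P ℝ) ⊔ (M.supNorm Q y : L0 P ℝ) := fun y => by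
      rw [supNorm, Finset.sup_insert]
      rfl
    have habs : ∀ᵐ ω ∂P, L0.abs ξ ω = ‖ξ ω‖ := AEEqFun.coeFn_comp _ _ ξ
    rw [h, h, M.norm_smul]
    filter_upwards [ih, AEEqFun.coeFn_sup (L0.abs ξ * (M.norm i x : L0 P ℝ))
      (M.supNorm Q (ξ • x) : L0 P ℝ), AEEqFun.coeFn_sup (M.norm i x : L0 P ℝ)
      (M.supNorm Q x : L0 P ℝ), L0.ae_mul (L0.abs ξ) (M.norm i x : L0 P ℝ), habs]
      with ω h1 h2 h3 h4 h5
    rw [h2, h3, h1, h4, h5]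
    exact (mul_max_of_nonneg _ _ (norm_nonneg _)).symm

/-- The seminorm `‖·‖_𝒬` of a finite subfamily, as an `L⁰`-seminorm over the real algebra. -/
def l0Seminorm (Q : Finset ι) :
    letI := L0.restrictScalars P K E
    L0Seminorm P E :=
  letI := L0.restrictScalars P K E
  { toFun := fun x => M.supNorm Q x
    nonneg' := fun x => by
      filter_upwards [L0.le_iff.1 (M.supNorm Q x).2, L0.ae_zero (P := P)] with ω h1 h2
      rwa [h2] at h1
    add_le' := fun x y => by
      filter_upwards [L0.le_iff.1 (M.supNorm_add_le Q x y),
        L0.ae_add (M.supNorm Q x : L0 P ℝ) (M.supNorm Q y : L0 P ℝ)] with ω h1 h2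
      rwa [h2] at h1
    smul' := fun ξ x => by
      filter_upwards [M.supNorm_smul Q (L0.ofReal K ξ) x, L0.ae_ofReal (K := K) ξ] with ω h1 h2
      rw [h2, RCLike.norm_ofReal] at h1
      exact h1 }

variable [IsProbabilityMeasure P]

theorem le_measureReal_of_notMem_nhd {Q : Finset ι} {ε lam : ℝ} {x : E}
    (hx : x ∉ M.nhd Q ε lam) : lam ≤ P.real {ω | ε ≤ (M.supNorm Q x : L0 P ℝ) ω} := by
  have h1 : P.real {ω | (M.supNorm Q x : L0 P ℝ) ω < ε} ≤ 1 - lam := not_lt.1 hx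
  have hm : MeasurableSet {ω | (M.supNorm Q x : L0 P ℝ) ω < ε} :=
    measurableSet_lt (AEEqFun.measurable _) measurable_const
  have h2 := probReal_compl_eq_one_sub (μ := P) hm
  have h3 : {ω | (M.supNorm Q x : L0 P ℝ) ω < ε}ᶜ = {ω | ε ≤ (M.supNorm Q x : L0 P ℝ) ω} := by
    ext ω
    simp
  rw [h3] at h2
  linarith

theorem measure_le_of_mem_nhd {Q : Finset ι} {ε lam : ℝ} (hlam : 0 ≤ lam) {x : E}
    (hx : x ∈ M.nhd Q ε lam) :
    P {ω | ε ≤ (M.supNorm Q x : L0 P ℝ) ω} ≤ ENNReal.ofReal lam := by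
  have h1 : 1 - lam < P.real {ω | (M.supNorm Q x : L0 P ℝ) ω < ε} := hx
  have hm : MeasurableSet {ω | (M.supNorm Q x : L0 P ℝ) ω < ε} :=
    measurableSet_lt (AEEqFun.measurable _) measurable_const
  have h2 := probReal_compl_eq_one_sub (μ := P) hm
  have h3 : {ω | (M.supNorm Q x : L0 P ℝ) ω < ε}ᶜ = {ω | ε ≤ (M.supNorm Q x : L0 P ℝ) ω} := by
    ext ω
    simp
  rw [h3, measureReal_def] at h2
  refine (ENNReal.le_ofReal_iff_toReal_le (measure_ne_top _ _) hlam).2 ?_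
  linarith

/-- A point of the closure is, for each finite subfamily of seminorms, the limit of a sequence that
converges almost surely: by the Borel–Cantelli lemma, convergence in probability at a summable rate
is enough. -/
theorem exists_seq_of_mem_closure {Z : Set E} {x : E} (hx : x ∈ @closure E M.topology Z)
    (Q : Finset ι) : ∃ z : ℕ → E, (∀ n, z n ∈ Z) ∧
      ∀ᵐ ω ∂P, Tendsto (fun n => (M.supNorm Q (z n - x) : L0 P ℝ) ω) atTop (𝓝 0) := by
  let := M.topology
  have hz : ∀ n : ℕ, ∃ z ∈ Z, z - x ∈ M.nhd Q (1 / ((n : ℝ) + 1)) ((1 / 2) ^ (n + 1)) := by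
    intro n
    have hU : M.nhd Q (1 / ((n : ℝ) + 1)) ((1 / 2) ^ (n + 1)) ∈ M.basis :=
      ⟨Q, _, _, Nat.one_div_pos_of_nat, by positivity,
        pow_lt_one₀ (by norm_num) (by norm_num) (Nat.succ_ne_zero n), rfl⟩
    obtain ⟨z, hzZ, y, hy, hyz⟩ :=
      (mem_closure_iff_nhds_basis (M.basis.nhds_hasBasis x)).1 hx _ hU
    refine ⟨z, hzZ, ?_⟩
    rw [← hyz]
    simpa using hy
  choose z hzZ hz using hz
  refine ⟨z, hzZ, ?_⟩
  have hsum : ∑' n : ℕ, P {ω | 1 / ((n : ℝ) + 1) ≤ (M.supNorm Q (z n - x) : L0 P ℝ) ω} ≠ ⊤ := by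
    have hs : Summable fun n : ℕ => ((1 : ℝ) / 2) ^ (n + 1) :=
      (summable_nat_add_iff 1).2 summable_geometric_two
    refine ne_top_of_le_ne_top hs.tsum_ofReal_ne_top (ENNReal.tsum_le_tsum fun n => ?_)
    exact M.measure_le_of_mem_nhd (by positivity) (hz n)
  have hnn : ∀ᵐ ω ∂P, ∀ n, 0 ≤ (M.supNorm Q (z n - x) : L0 P ℝ) ω :=
    ae_all_iff.2 fun n => by
      filter_upwards [L0.le_iff.1 (M.supNorm Q (z n - x)).2, L0.ae_zero (P := P)] with ω h1 h2
      rwa [h2] at h1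
  filter_upwards [ae_eventually_notMem hsum, hnn] with ω h1 h2
  refine tendsto_of_tendsto_of_tendsto_of_le_of_le' tendsto_const_nhds
    (tendsto_one_div_add_atTop_nhds_zero_nat (𝕜 := ℝ)) (Eventually.of_forall h2) ?_
  filter_upwards [h1] with n h3
  exact (not_le.1 h3).le

/-- The `(ε, λ)`-topology is generated by the directed family of the `‖·‖_𝒬`. -/
theorem isEpsilonLambda :
    letI := L0.restrictScalars P K E
    IsEpsilonLambda M.topology M.l0Seminorm := by
  classical
  let := L0.restrictScalars P K E
  refine ⟨⟨∅⟩, fun Q R => ⟨Q ∪ R, fun x => M.supNorm_mono Finset.subset_union_left x,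
    fun x => M.supNorm_mono Finset.subset_union_right x⟩, fun Z Q h => ?_, fun Z hZ x hx => ?_⟩
  · let := M.topology
    refine isClosed_of_closure_subset fun x hx => ?_
    obtain ⟨z, hz, hlim⟩ := M.exists_seq_of_mem_closure hx Q
    exact h x z hz hlim
  · let := M.topology
    have h1 : Zᶜ ∈ 𝓝 x := hZ.isOpen_compl.mem_nhds hx
    obtain ⟨_, ⟨Q, ε, lam, hε, hlam, _, rfl⟩, hU⟩ := (M.basis.nhds_hasBasis x).mem_iff.1 h1
    refine ⟨Q, ε, lam, hε, hlam, fun z hz => M.le_measureReal_of_notMem_nhd fun hmem => ?_⟩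
    exact hU ⟨z - x, hmem, by simp⟩ hz

end RandomLCModule

end

theorem theorem5p3 {Ω : Type*} [MeasurableSpace Ω] (P : Measure Ω) [IsProbabilityMeasure P]
    (K : Type*) [RCLike K] {ι : Type*} {E : Type*} [AddCommGroup E] [Module (L0 P K) E]
    (M : RandomLCModule P K ι E) (hM : M.IsComplete)
    (G : Set E) (hG_closed : IsClosed[M.topology] G) (hG_convex : IsL0Convex P K G)
    (hG_compact : IsL0ConvexlyCompact P K M.topology G) :
    IsConvexlyCompact P K M.topology G := by
  let := L0.realModule P K E
  let := L0.restrictScalars P K E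
  have := L0.isScalarTower_restrictScalars P K E
  have hG := (isL0Convex_iff_realL0Convex P K G).1 hG_convex
  refine ⟨hG.convex, M.isEpsilonLambda.isFIPCompact_convex hG fun 𝓕 hne h𝓕 hfip => ?_⟩
  exact hG_compact.2 𝓕 hne
    (fun F hF => ⟨(isL0Convex_iff_realL0Convex P K F).2 (h𝓕 F hF).1, (h𝓕 F hF).2⟩) hfip
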